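/- Let $m,n\geq 0$, put $\bar i=0$ for $1\le i\le m$ and $\bar i=1$ for $m<i\le m+n$, and let $R(u)=1-hPu^{-1}$ with $P=\sum_{i,j}(-1)^{\bar j}e_{ij}\otimes e_{ji}$. Let $\mathrm{DY}(\mathfrak{gl}_{m|n})$ be the $h$-adically completed unital associative superalgebra over $\mathbb{C}[[h]]$ generated by elements $t_{ij}^{(\pm r)}$ of parity $\bar i+\bar j$ ($1\le i,j\le m+n$, $r\ge 1$), subject to the relations $$R(u-v)T_1^{\pm}(u)T_2^{\pm}(v)=T_2^{\pm}(v)T_1^{\pm}(u)R(u-v),\qquad R(u-v)T_1^{-}(u)T_2^{+}(v)=T_2^{+}(v)T_1^{-}(u)R(u-v),$$ where $T^\pm(u)=\sum_{i,j}(-1)^{\bar i\bar j+\bar j}e_{ij}\otimes t^\pm_{ij}(u)$, $t^-_{ij}(u)=\delta_{ij}+h\sum_{r\ge1}t^{(r)}_{ij}u^{-r}$, $t^+_{ij}(u)=\delta_{ij}-h\sum_{r\ge1}t^{(-r)}_{ij}u^{r-1}$, and where the common powers of $h$ in the coefficients of the relations are cancelled. The matrices $T^\pm(u)$ are invertible;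 write $T^\pm(u)^{-1}=\sum_{i,j}(-1)^{\bar i\bar j+\bar j}e_{ij}\otimes t^{\pm\prime}_{ij}(u)$. The leading submatrices of $(t^\pm_{ij}(u))$ are invertible as well; let $d_i^\pm(u)$ be the quasideterminant of the leading $i\times i$ submatrix with respect to its entry $t^\pm_{ii}(u)$, that is, $d^\pm_i(u)=t^\pm_{ii}(u)-\sum_{a,b<i}t^\pm_{ia}(u)\,(M^{-1})_{ab}\,t^\pm_{bi}(u)$ with $M=(t^\pm_{ab}(u))_{a,b<i}$. Then the $d_i^\pm(u)$ are invertible and they are the diagonal entries in the Gauss decomposition $T^\pm(u)=F^\pm(u)D^\pm(u)E^\pm(u)$, with $F^\pm(u)$ lower and $E^\pm(u)$ upper unitriangular and $D^\pm(u)=\mathrm{diag}(d^\pm_1(u),\dots,d^\pm_{m+n}(u))$. Moreover, the quantum Berezinian $$b^\pm_{m|n}(u)=\sum_{\tau\in\mathfrak S_m}\operatorname{sgn}\tau\; t^\pm_{\tau(1)1}(u)\cdots t^\pm_{\tau(m)m}(u-(m-1)h)\;\times\sum_{\sigma\in\mathfrak S_n}\operatorname{sgn}\sigma\; t^{\pm\prime}_{m+1\,m+\sigma(1)}(u-(m-1)h)\cdots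 t^{\pm\prime}_{m+n\,m+\sigma(n)}(u-(m-n)h)$$ satisfies $$b^\pm_{m|n}(u)=d_1^\pm(u)\cdots d_m^\pm(u-(m-1)h)\;d_{m+1}^\pm(u-(m-1)h)^{-1}\cdots d_{m+n}^\pm(u-(m-n)h)^{-1},$$ an identity of series in $u^{-1}$ for the sign $-$ and in $u$ for the sign $+$. -/

import Mathlib

namespace DoubleYangian

/-! ### The `h`-adic completion of an associative algebra over `ℂ[[h]]` -/

/-- The commutative ring `ℂ[[h]]`. -/
def Base : Type := PowerSeries ℂ

noncomputable instance : CommRing Base := inferInstanceAs (CommRing (PowerSeries ℂ))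

/-- The formal parameter `h` of `ℂ[[h]]`. -/
noncomputable def hbar : Base := (PowerSeries.X : PowerSeries ℂ)

section Completion

variable (B : Type) [Ring B] [Algebra Base B]

/-- The two-sided ideal `h ^ k B`. -/
noncomputable def hIdeal (k : ℕ) : Ideal B where
  carrier := {x | ∃ y : B, x = (hbar ^ k) • y}
  add_mem' := by
    rintro _ _ ⟨x, rfl⟩ ⟨y, rfl⟩
    exact ⟨x + y, by rw [smul_add]⟩
  zero_mem' := ⟨0, by rw [smul_zero]⟩
  smul_mem' := by
    rintro c _ ⟨x, rfl⟩
    exact ⟨c * x, by rw [smul_eq_mul, mul_smul_comm]⟩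

instance (k : ℕ) : (hIdeal B k).IsTwoSided :=
  ⟨by
    rintro _ b ⟨x, rfl⟩
    exact ⟨x * b, by rw [smul_mul_assoc]⟩⟩

theorem hIdeal_succ_le (k : ℕ) : hIdeal B (k + 1) ≤ hIdeal B k := by
  rintro _ ⟨x, rfl⟩
  exact ⟨hbar • x, by rw [smul_smul, pow_succ]⟩

/-- The algebra of coherent sequences in `∏ B / h ^ k B`. -/
noncomputable def coherent : Subalgebra Base (∀ k : ℕ, B ⧸ hIdeal B k) where
  carrier := {x | ∀ k, Ideal.Quotient.factorₐ Base (hIdeal_succ_le B k) (x (k + 1)) = x k}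
  mul_mem' := by
    intro x y hx hy k
    rw [Pi.mul_apply, Pi.mul_apply, map_mul, hx k, hy k]
  add_mem' := by
    intro x y hx hy k
    rw [Pi.add_apply, Pi.add_apply, map_add, hx k, hy k]
  algebraMap_mem' := by
    intro r k
    rw [Pi.algebraMap_apply, Pi.algebraMap_apply, AlgHom.commutes]

/-- The `h`-adic completion `lim B / h ^ k B`. -/
def Completion : Type := coherent B

noncomputable instance : Ring (Completion B) := inferInstanceAs (Ring (coherent B))

noncomputable instance : Algebra Base (Completion B) :=
  inferInstanceAs (Algebra Base (coherent B))

/-- The canonical homomorphism from an algebra to its `h`-adic completion. -/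
noncomputable def toCompletion : B →ₐ[Base] Completion B :=
  AlgHom.codRestrict (AlgHom.pi fun k => Ideal.Quotient.mkₐ Base (hIdeal B k)) (coherent B)
    (fun _ _ => rfl)

variable {B}

theorem hbar_pow_smul_quotient (k : ℕ) (x : B ⧸ hIdeal B k) : (hbar ^ k) • x = 0 := by
  obtain ⟨x, rfl⟩ := Ideal.Quotient.mk_surjective x
  exact Ideal.Quotient.eq_zero_iff_mem.2 ⟨x, rfl⟩

/-- The sum `∑_{s ≥ 0} h ^ s a_s` of an `h`-adically convergent series in the completion. Modulo
`h ^ k` it is the finite sum of the terms with `s < k`. -/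
noncomputable def hSum (a : ℕ → Completion B) : Completion B :=
  ⟨fun k => ∑ s ∈ Finset.range k, (hbar ^ s) • (a s).1 k, by
    intro k
    rw [map_sum, Finset.sum_range_succ]
    simp_rw [map_smul, (a _).2 k]
    rw [hbar_pow_smul_quotient, add_zero]⟩

end Completion

/-! ### The double Yangian of `gl_{m|n}` -/

/-- The sign in `T⁺(u)`, `T⁻(u)`. -/
inductive YSign
  | plus
  | minus

/-- `(ε, i, j, r)` is the label of the generator `t_{ij}^{(r+1)}` for `ε = minus`,
and of `t_{ij}^{(-(r+1))}` for `ε = plus`. -/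
abbrev Gen (m n : ℕ) : Type := YSign × Fin (m + n) × Fin (m + n) × ℕ

/-- The free associative algebra over `ℂ[[h]]` on the generators. -/
abbrev Free (m n : ℕ) : Type := FreeAlgebra Base (Gen m n)

/-- The parity of an index: the first `m` indices are even, the last `n` indices are odd. -/
def parity {m n : ℕ} (i : Fin (m + n)) : ℕ := if (i : ℕ) < m then 0 else 1

/-- The sign `(-1) ^ p`. -/
def sgn (p : ℕ) : ℤ := (-1) ^ p

section Relations

variable {m n : ℕ}

/-- The coefficient of `u ^ a` in `t^ε_{ij}(u)`, where
`t⁻_{ij}(u) = δ_{ij} + h ∑_{r ≥ 1} t_{ij}^{(r)} u^{-r}` and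
`t⁺_{ij}(u) = δ_{ij} - h ∑_{r ≥ 1} t_{ij}^{(-r)} u^{r-1}`. -/
noncomputable def tCoeff (ε : YSign) (i j : Fin (m + n)) (a : ℤ) : Free m n :=
  (if a = 0 ∧ i = j then 1 else 0) +
    match ε with
    | .minus =>
        if a < 0 then hbar • FreeAlgebra.ι Base (YSign.minus, i, j, (-a - 1).toNat) else 0
    | .plus =>
        if 0 ≤ a then -(hbar • FreeAlgebra.ι Base (YSign.plus, i, j, a.toNat)) else 0

variable (m n) in
/-- An even element `∑ e_{ij} ⊗ e_{kl} ⊗ x_{ijkl}` of the super tensor product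
`End ℂ^{m|n} ⊗ End ℂ^{m|n} ⊗ A` (`A` the free algebra), given by its coefficients; so `x_{ijkl}`
is of parity `ī + j̄ + k̄ + l̄`. -/
abbrev Tensor : Type := Fin (m + n) → Fin (m + n) → Fin (m + n) → Fin (m + n) → Free m n

/-- Multiplication of even elements of `End ℂ^{m|n} ⊗ End ℂ^{m|n} ⊗ A`. The sign in
`(e_{ia} ⊗ e_{kb} ⊗ x) (e_{aj} ⊗ e_{bl} ⊗ y) = ± e_{ij} ⊗ e_{kl} ⊗ x y` comes from moving `x` past
`e_{aj} ⊗ e_{bl}` and `e_{kb}` past `e_{aj}`. -/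
noncomputable def Tensor.mul (X Y : Tensor m n) : Tensor m n := fun i j k l =>
  ∑ a, ∑ b,
    sgn ((parity i + parity a + parity k + parity b) * (parity a + parity j + parity b + parity l) +
        (parity k + parity b) * (parity a + parity j)) •
      (X i a k b * Y a j b l)

variable (m n) in
/-- `P = ∑ (-1)^{j̄} e_{ij} ⊗ e_{ji}`. -/
noncomputable def tensorP : Tensor m n := fun i j k l =>
  if k = j ∧ l = i then ((sgn (parity j) : ℤ) : Free m n) else 0

/-- The coefficient of `u ^ a` in `T_1^ε(u) = ∑ (-1)^{īj̄+j̄} e_{ij} ⊗ 1 ⊗ t^ε_{ij}(u)`. -/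
noncomputable def tensorT1 (ε : YSign) (a : ℤ) : Tensor m n := fun i j k l =>
  if k = l then sgn (parity i * parity j + parity j) • tCoeff ε i j a else 0

/-- The coefficient of `v ^ b` in `T_2^ε(v) = ∑ (-1)^{k̄l̄+l̄} 1 ⊗ e_{kl} ⊗ t^ε_{kl}(v)`. -/
noncomputable def tensorT2 (ε : YSign) (b : ℤ) : Tensor m n := fun i j k l =>
  if i = j then sgn (parity k * parity l + parity l) • tCoeff ε k l b else 0

/-- The coefficient of `u ^ a v ^ b` in
`(u - v - h P) T_1^ε(u) T_2^ε'(v) - T_2^ε'(v) T_1^ε(u) (u - v - h P)`, where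
`u - v - h P = (u - v) R(u - v)`. -/
noncomputable def rttCoeff (ε ε' : YSign) (a b : ℤ) : Tensor m n :=
  ((tensorT1 ε (a - 1)).mul (tensorT2 ε' b) - (tensorT1 ε a).mul (tensorT2 ε' (b - 1))
      - hbar • (tensorP m n).mul ((tensorT1 ε a).mul (tensorT2 ε' b))) -
    ((tensorT2 ε' b).mul (tensorT1 ε (a - 1)) - (tensorT2 ε' (b - 1)).mul (tensorT1 ε a)
      - hbar • ((tensorT2 ε' b).mul (tensorT1 ε a)).mul (tensorP m n))

variable (m n) in
/-- The defining relations: the coefficients of the `RTT` relations for `T⁺, T⁺`, for `T⁻, T⁻` and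
for `T⁻, T⁺`, where a common power of `h` is cancelled. (Every coefficient carries the factor
`h ^ 2` because of the factor `h` in front of the generators in `t^ε_{ij}(u)`; without cancelling
it the quotient would have `h`-torsion.) -/
inductive Rel : Free m n → Free m n → Prop
  | same (ε : YSign) (a b : ℤ) (i j k l : Fin (m + n)) (N : ℕ) (x : Free m n)
      (hx : (hbar ^ N) • x = rttCoeff ε ε a b i j k l) : Rel x 0
  | mixed (a b : ℤ) (i j k l : Fin (m + n)) (N : ℕ) (x : Free m n)
      (hx : (hbar ^ N) • x = rttCoeff YSign.minus YSign.plus a b i j k l) : Rel x 0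

end Relations

/-- The algebra over `ℂ[[h]]` with the given generators and defining relations. -/
def Presented (m n : ℕ) : Type := RingQuot (Rel m n)

noncomputable instance (m n : ℕ) : Ring (Presented m n) := inferInstanceAs (Ring (RingQuot (Rel m n)))

noncomputable instance (m n : ℕ) : Algebra Base (Presented m n) :=
  inferInstanceAs (Algebra Base (RingQuot (Rel m n)))

/-- The canonical projection of the free algebra. -/
noncomputable def toPresented (m n : ℕ) : Free m n →ₐ[Base] Presented m n :=
  RingQuot.mkAlgHom Base (Rel m n)

/-- The double Yangian `DY(gl_{m|n})`, completed `h`-adically. -/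
abbrev DY (m n : ℕ) : Type := Completion (Presented m n)

/-- The image in `DY(gl_{m|n})` of the generator `t_{ij}^{(r+1)}` for `ε = minus`,
and of `t_{ij}^{(-(r+1))}` for `ε = plus`. -/
noncomputable def gen {m n : ℕ} (ε : YSign) (i j : Fin (m + n)) (r : ℕ) : DY m n :=
  toCompletion (Presented m n) (toPresented m n (FreeAlgebra.ι Base (ε, i, j, r)))

/-- Formal power series over `DY(gl_{m|n})`. They are read as series in `u` when they come from
`T⁺(u)` and as series in `u⁻¹` when they come from `T⁻(u)`. -/
abbrev Series (m n : ℕ) : Type := PowerSeries (DY m n)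

/-- The substitution `u ↦ u - c h` in a series in `u`, for `ε = plus`, or in `u⁻¹`, for
`ε = minus`:
`(u - c h)^{j+s} = ∑ binom(j+s, s) (-c h)^s u^j` and
`(u - c h)^{-r} = ∑ binom(r+s-1, s) (c h)^s u^{-(r+s)}`
(for `r = 0` the latter binomial coefficient is `1` for `s = 0` and `0` for `s > 0`, in accordance
with truncated subtraction). -/
noncomputable def shift {m n : ℕ} (ε : YSign) (c : ℤ) (f : Series m n) : Series m n :=
  match ε with
  | .plus => PowerSeries.mk fun j =>
      hSum fun s => ((-c) ^ s * ((j + s).choose s : ℤ)) • PowerSeries.coeff (j + s) f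
  | .minus => PowerSeries.mk fun N =>
      ∑ p ∈ Finset.HasAntidiagonal.antidiagonal N,
        (hbar ^ p.2) • ((c ^ p.2 * ((p.1 + p.2 - 1).choose p.2 : ℤ)) • PowerSeries.coeff p.1 f)

/-- The series `t^ε_{ij}(u)`, in `u` for `ε = plus` and in `u⁻¹` for `ε = minus`. -/
noncomputable def t {m n : ℕ} (ε : YSign) (i j : Fin (m + n)) : Series m n :=
  PowerSeries.mk fun k =>
    (if k = 0 ∧ i = j then 1 else 0) +
      match ε with
      | .minus => if k = 0 then 0 else hbar • gen YSign.minus i j (k - 1)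
      | .plus => -(hbar • gen YSign.plus i j k)

/-- The matrix `(t^ε_{ij}(u))`. The signs in `T^ε(u) = ∑ (-1)^{īj̄+j̄} e_{ij} ⊗ t^ε_{ij}(u)` make the
product in the super tensor product correspond to the usual product of the matrices of entries. -/
noncomputable def T (m n : ℕ) (ε : YSign) : Matrix (Fin (m + n)) (Fin (m + n)) (Series m n) :=
  Matrix.of fun i j => t ε i j

/-- The series `t^ε'_{ij}(u)`, the entries of the inverse matrix. -/
noncomputable def tInv {m n : ℕ} (ε : YSign) (i j : Fin (m + n)) : Series m n :=
  Ring.inverse (T m n ε) i j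

/-- The `r × r` submatrix in the upper left corner of `T^ε(u)`. -/
noncomputable def leading {m n : ℕ} (ε : YSign) (r : ℕ) (hr : r ≤ m + n) :
    Matrix (Fin r) (Fin r) (Series m n) :=
  (T m n ε).submatrix (Fin.castLE hr) (Fin.castLE hr)

/-- The quasideterminant `|A|_{ij} = a_{ij} - r_i^j (A^{ij})⁻¹ c_j^i`, where `A^{ij}` is `A` without
its row `i` and column `j`, provided that `A^{ij}` is invertible. -/
noncomputable def quasideterminant {S : Type} [Ring S] {r : ℕ}
    (A : Matrix (Fin (r + 1)) (Fin (r + 1)) S) (i j : Fin (r + 1)) : S :=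
  A i j - ∑ a, ∑ b, A i (j.succAbove a) *
    Ring.inverse (A.submatrix i.succAbove j.succAbove) a b * A (i.succAbove b) j

/-- The series `d^ε_i(u)` of the Gauss decomposition: the quasideterminant of the leading
submatrix of size `i`, with respect to its lower right entry `t^ε_{ii}(u)`. -/
noncomputable def d {m n : ℕ} (ε : YSign) (i : Fin (m + n)) : Series m n :=
  quasideterminant (leading ε ((i : ℕ) + 1) i.isLt) (Fin.last i) (Fin.last i)

/-- The quantum Berezinian `b^ε_{m|n}(u)`. -/
noncomputable def berezinian (m n : ℕ) (ε : YSign) : Series m n :=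
  (∑ τ : Equiv.Perm (Fin m), ((Equiv.Perm.sign τ : ℤ)) •
      (List.ofFn fun k : Fin m =>
        shift ε (k : ℤ) (t ε (Fin.castAdd n (τ k)) (Fin.castAdd n k))).prod) *
    (∑ σ : Equiv.Perm (Fin n), ((Equiv.Perm.sign σ : ℤ)) •
      (List.ofFn fun k : Fin n =>
        shift ε ((m : ℤ) - 1 - k) (tInv ε (Fin.natAdd m k) (Fin.natAdd m (σ k)))).prod)

end DoubleYangian

/-! Each factor of the quantum Berezinian is an alternating sum `altSum X id` of ordered products,
and the argument is noncommutative Gaussian elimination. The RTT relation at spectral parameters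
differing by `h` degenerates to exchange relations between neighbouring factors (`IsExchange`).
These make `altSum X` alternating in its column labels, so the column of the last factor may be
changed by right multiples of other columns, or that of the first factor by left multiples.
Triangularizing one factor at a time leaves a product of pivots (`altSum_eq_prod_of_columns`,
`altSum_eq_prod_of_rows`).

For the even block the column operations come from `colOp`, and the pivots are the
quasideterminants. For the odd block, inverting RTT gives exchange relations for the entries of
`T⁻¹`. From `T = F D E` follows `E T⁻¹ = D⁻¹ F⁻¹`, which is lower triangular with diagonal `D⁻¹`, so
the rows of `E` do the elimination. As `colOp` and `E` are upper triangular, neither elimination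
leaves its block.

All inverses exist because `T` is congruent to `1` modulo `h` and the algebra is `h`-adically
complete. The analytic input is that `u ↦ u - c h` is a ring homomorphism (`shiftHom`) and turns `u
- v` into `(d - c) h` (`DividesDifference.sum_eq`); both are checked modulo each `h ^ k`, where all
sums are finite. No division by `h` occurs after the substitution: the relations enter with one
power of `h` already cancelled, and the factor `h` of `(d - c) h` restores it (`shift_exchange`). -/

namespace DoubleYangian

/-! ### Alternating sums of ordered noncommuting products -/

section AlternatingSums

variable {S : Type*} [Ring S]

/-- A product over `Fin N` depends on two adjacent factors only through their product. -/
theorem exists_prod_ofFn_eq {N : ℕ} (f : Fin N → S) (p q : Fin N) (hpq : (q : ℕ) = p + 1) :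
    ∃ A B : S, ∀ g : Fin N → S, (∀ r, r ≠ p → r ≠ q → g r = f r) →
      (List.ofFn g).prod = A * (g p * g q) * B := by
  induction N with
  | zero => exact p.elim0
  | succ N ih =>
    obtain ⟨q, rfl⟩ := Fin.exists_succ_eq.2 (show q ≠ 0 by rintro rfl; simp at hpq)
    rcases Fin.eq_zero_or_eq_succ p with rfl | ⟨p, rfl⟩
    · obtain _ | N := N
      · exact q.elim0
      obtain rfl : q = 0 := by ext; simpa using hpq
      refine ⟨1, (List.ofFn fun r : Fin N => f r.succ.succ).prod, fun g hg => ?_⟩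
      rw [List.ofFn_succ, List.ofFn_succ, List.prod_cons, List.prod_cons, one_mul, mul_assoc]
      congr 4
      funext r
      exact hg _ (Fin.succ_ne_zero _) (by simp [Fin.ext_iff])
    · obtain ⟨A, B, h⟩ := ih (fun r => f r.succ) p q (by simpa using hpq)
      refine ⟨f 0 * A, B, fun g hg => ?_⟩
      rw [List.ofFn_succ, List.prod_cons, h (fun r => g r.succ)
        fun r h1 h2 => hg _ (by simpa using h1) (by simpa using h2),
        hg 0 (Fin.succ_ne_zero _).symm (Fin.succ_ne_zero _).symm]
      simp only [mul_assoc]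

/-- The alternating sum `∑_τ sgn τ ∏_p X_p (τ p) (c p)`, where the factors are ordered by `p`. -/
def altSum {N : ℕ} {κ : Type*} (X : Fin N → Fin N → κ → S) (c : Fin N → κ) : S :=
  ∑ τ : Equiv.Perm (Fin N), (Equiv.Perm.sign τ : ℤ) •
    (List.ofFn fun p => X p (τ p) (c p)).prod

/-- The exchange relations between neighbouring factors which make `altSum X` alternating. -/
structure IsExchange {N : ℕ} {κ : Type*} (X : Fin N → Fin N → κ → S) : Prop where
  same (p q : Fin N) (hpq : (q : ℕ) = p + 1) (i k : Fin N) (a : κ) :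
    X p i a * X q k a = X p k a * X q i a
  swap (p q : Fin N) (hpq : (q : ℕ) = p + 1) (i k : Fin N) (a b : κ) :
    X p i a * X q k b + X p i b * X q k a = X p k a * X q i b + X p k b * X q i a

/-- The involution `τ ↦ τ * swap p q` pairs terms of opposite sign. -/
theorem sum_sign_smul_eq_zero {N : ℕ} (F : Equiv.Perm (Fin N) → S) {p q : Fin N} (hpq : p ≠ q)
    (hF : ∀ τ, F (τ * Equiv.swap p q) = F τ) :
    ∑ τ : Equiv.Perm (Fin N), (Equiv.Perm.sign τ : ℤ) • F τ = 0 := by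
  refine Finset.sum_involution (fun τ _ => τ * Equiv.swap p q) ?_ ?_ ?_ ?_
  · intro τ _
    rw [hF, Equiv.Perm.sign_mul, Equiv.Perm.sign_swap hpq]
    simp
  · intro τ _ _ h
    exact hpq (Equiv.swap_eq_one_iff.1 (mul_eq_left.1 h))
  · intro τ _
    exact Finset.mem_univ _
  · intro τ _
    simp [mul_assoc]

theorem swap_fix {N : ℕ} {p q r : Fin N} (τ : Equiv.Perm (Fin N)) (h1 : r ≠ p) (h2 : r ≠ q) :
    (τ * Equiv.swap p q) r = τ r := by
  rw [Equiv.Perm.mul_apply, Equiv.swap_apply_of_ne_of_ne h1 h2]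

variable {N : ℕ} {κ : Type*} {X : Fin N → Fin N → κ → S}

theorem IsExchange.altSum_eq_zero_of_adjacent (hX : IsExchange X) (c : Fin N → κ) {p q : Fin N}
    (hpq : (q : ℕ) = p + 1) (hc : c p = c q) : altSum X c = 0 := by
  have hne : p ≠ q := by rintro rfl; omega
  refine sum_sign_smul_eq_zero _ hne fun τ => ?_
  obtain ⟨A, B, h⟩ := exists_prod_ofFn_eq (fun r => X r (τ r) (c r)) p q hpq
  rw [h _ fun r h1 h2 => by rw [swap_fix τ h1 h2], h _ fun r h1 h2 => rfl]
  simp only [Equiv.Perm.mul_apply, Equiv.swap_apply_left, Equiv.swap_apply_right, hc]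
  rw [hX.same p q hpq]

/-- Neither sum is related to the other term by term. Only in their sum does `IsExchange.swap` make
the summand invariant under `τ ↦ τ * swap p q`. -/
theorem IsExchange.altSum_swap (hX : IsExchange X) (c : Fin N → κ) {p q : Fin N}
    (hpq : (q : ℕ) = p + 1) : altSum X (c ∘ Equiv.swap p q) = -altSum X c := by
  have hne : p ≠ q := by rintro rfl; omega
  rw [eq_neg_iff_add_eq_zero, altSum, altSum, ← Finset.sum_add_distrib]
  simp_rw [← smul_add]
  refine sum_sign_smul_eq_zero _ hne fun τ => ?_
  obtain ⟨A, B, h⟩ := exists_prod_ofFn_eq (fun r => X r (τ r) (c r)) p q hpq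
  have hc : ∀ r, r ≠ p → r ≠ q → (c ∘ Equiv.swap p q) r = c r := fun r h1 h2 => by
    rw [Function.comp_apply, Equiv.swap_apply_of_ne_of_ne h1 h2]
  rw [h _ fun r h1 h2 => by rw [swap_fix τ h1 h2, hc r h1 h2],
    h _ fun r h1 h2 => by rw [swap_fix τ h1 h2], h _ fun r h1 h2 => by rw [hc r h1 h2],
    h _ fun r h1 h2 => rfl]
  simp only [Equiv.Perm.mul_apply, Equiv.swap_apply_left, Equiv.swap_apply_right,
    Function.comp_apply]
  rw [← add_mul, ← add_mul, ← mul_add, ← mul_add, hX.swap p q hpq]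

theorem IsExchange.altSum_eq_zero (hX : IsExchange X) (c : Fin N → κ) {p q : Fin N}
    (hpq : p < q) (hc : c p = c q) : altSum X c = 0 := by
  obtain ⟨k, hk⟩ : ∃ k : ℕ, (q : ℕ) = p + 1 + k := ⟨q - (p + 1), by have : (p : ℕ) < q := hpq; omega⟩
  induction k generalizing q c with
  | zero => exact hX.altSum_eq_zero_of_adjacent c hk hc
  | succ k ih =>
    -- Move the repeated column one place to the left, at the cost of a sign, until the two equal
    -- columns are adjacent.
    let q' : Fin N := ⟨q - 1, by omega⟩
    have hq' : (q' : ℕ) = q - 1 := rfl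
    have h1 : p < q' := by rw [Fin.lt_def, hq']; omega
    have h2 := ih (c ∘ Equiv.swap q' q) h1 (by
      simp only [Function.comp_apply, Equiv.swap_apply_left]
      rw [Equiv.swap_apply_of_ne_of_ne h1.ne hpq.ne, hc]) (by omega)
    rwa [hX.altSum_swap c (by omega), neg_eq_zero] at h2

/-- The permutations of `Fin (N + 1)` which fix `a` are the permutations of the other points. -/
theorem sum_perm_fixing {N : ℕ} {M : Type*} [AddCommMonoid M] (a : Fin (N + 1))
    (F : Equiv.Perm (Fin (N + 1)) → M) :
    ∑ τ : Equiv.Perm (Fin (N + 1)) with τ a = a, F τ =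
      ∑ e : Equiv.Perm (Fin N), F (e.extendDomain (finSuccAboveEquiv a)) := by
  symm
  refine Finset.sum_bij (fun e _ => e.extendDomain (finSuccAboveEquiv a)) ?_ ?_ ?_ fun _ _ => rfl
  · intro e _
    simp [Equiv.Perm.extendDomain_apply_not_subtype]
  · intro e _ e' _ h
    exact Equiv.Perm.extendDomainHom_injective (finSuccAboveEquiv a) h
  · intro τ hτ
    replace hτ : τ a = a := by simpa using hτ
    refine ⟨(finSuccAboveEquiv a).symm.permCongr (τ.subtypePerm (p := fun x => x ≠ a) fun x => ?_),
      Finset.mem_univ _, ?_⟩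
    · constructor
      · rintro h rfl
        exact h hτ
      · intro h h'
        exact h (τ.injective (h'.trans hτ.symm))
    · ext1 x
      by_cases hx : x = a
      · rw [Equiv.Perm.extendDomain_apply_not_subtype (p := fun x => x ≠ a) _ _ (not_not.2 hx), hx, hτ]
      · rw [Equiv.Perm.extendDomain_apply_subtype (p := fun x => x ≠ a) _ _ hx]
        simp [Equiv.permCongr_apply]

theorem extendDomain_succAbove {N : ℕ} (a : Fin (N + 1)) (e : Equiv.Perm (Fin N)) (x : Fin N) :
    e.extendDomain (finSuccAboveEquiv a) (a.succAbove x) = a.succAbove (e x) :=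
  Equiv.Perm.extendDomain_apply_image e (finSuccAboveEquiv a) x

/-- Column operation on the last factor: replacing its column label by `k ≠ last` repeats a column
and gives zero, so the combination with coefficients `g` does not change the sum. The new last
column is zero above `δ`, and expansion along it leaves one minor. -/
theorem IsExchange.altSum_last {N : ℕ} {X : Fin (N + 1) → Fin (N + 1) → Fin (N + 1) → S}
    (hX : IsExchange X) (g : Fin (N + 1) → S) (δ : S) (hg : g (Fin.last N) = 1)
    (hXg : ∀ i, ∑ j, X (Fin.last N) i j * g j = if i = Fin.last N then δ else 0) :
    altSum X id =
      altSum (fun (p i j : Fin N) => X p.castSucc i.castSucc j.castSucc) id * δ := by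
  -- The `z i` are the cofactors of the last factor; they do not depend on its column label.
  let z (i : Fin (N + 1)) : S := ∑ τ : Equiv.Perm (Fin (N + 1)) with τ (Fin.last N) = i,
    (Equiv.Perm.sign τ : ℤ) • (List.ofFn fun p : Fin N => X p.castSucc (τ p.castSucc) p.castSucc).prod
  let D (k : Fin (N + 1)) : S := altSum X (Function.update id (Fin.last N) k)
  have hD : ∀ k, D k = ∑ i, z i * X (Fin.last N) i k := by
    intro k
    simp only [D, altSum]
    rw [← Finset.sum_fiberwise Finset.univ (fun τ : Equiv.Perm (Fin (N + 1)) => τ (Fin.last N))]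
    refine Finset.sum_congr rfl fun i _ => ?_
    rw [Finset.sum_mul]
    refine Finset.sum_congr rfl fun τ hτ => ?_
    rw [(Finset.mem_filter.1 hτ).2.symm, smul_mul_assoc, List.ofFn_succ_last, List.prod_append]
    simp [(Fin.castSucc_lt_last _).ne]
  have h0 : ∀ k, k ≠ Fin.last N → D k = 0 := fun k hk =>
    hX.altSum_eq_zero _ (lt_of_le_of_ne (Fin.le_last k) hk) (by simp [hk])
  have h1 : ∑ k, D k * g k = altSum X id := by
    rw [Finset.sum_eq_single (Fin.last N) (fun k _ hk => by rw [h0 k hk, zero_mul])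
      (by simp), hg, mul_one]
    simp only [D]
    congr 1
    exact Function.update_eq_self (Fin.last N) id
  rw [← h1]
  simp_rw [hD, Finset.sum_mul, mul_assoc]
  rw [Finset.sum_comm]
  simp_rw [← Finset.mul_sum, hXg]
  rw [Finset.sum_eq_single (Fin.last N) (fun k _ hk => by rw [if_neg hk, mul_zero])
    (by simp), if_pos rfl]
  congr 1
  simp only [z, altSum]
  rw [sum_perm_fixing]
  refine Finset.sum_congr rfl fun e _ => ?_
  rw [Equiv.Perm.sign_extendDomain]
  simp_rw [← Fin.succAbove_last_apply, extendDomain_succAbove, id]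

/-- Mirror image of `altSum_last`: the first factor can be combined only from the left, so the
coefficients and `δ` stand on the left. -/
theorem IsExchange.altSum_zero {N : ℕ} {X : Fin (N + 1) → Fin (N + 1) → Fin (N + 1) → S}
    (hX : IsExchange X) (g : Fin (N + 1) → S) (δ : S) (hg : g 0 = 1)
    (hXg : ∀ i, ∑ j, g j * X 0 i j = if i = 0 then δ else 0) :
    altSum X id = δ * altSum (fun (p i j : Fin N) => X p.succ i.succ j.succ) id := by
  let z (i : Fin (N + 1)) : S := ∑ τ : Equiv.Perm (Fin (N + 1)) with τ 0 = i,
    (Equiv.Perm.sign τ : ℤ) • (List.ofFn fun p : Fin N => X p.succ (τ p.succ) p.succ).prod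
  let D (k : Fin (N + 1)) : S := altSum X (Function.update id 0 k)
  have hD : ∀ k, D k = ∑ i, X 0 i k * z i := by
    intro k
    simp only [D, altSum]
    rw [← Finset.sum_fiberwise Finset.univ (fun τ : Equiv.Perm (Fin (N + 1)) => τ 0)]
    refine Finset.sum_congr rfl fun i _ => ?_
    rw [Finset.mul_sum]
    refine Finset.sum_congr rfl fun τ hτ => ?_
    rw [(Finset.mem_filter.1 hτ).2.symm, mul_smul_comm, List.ofFn_succ, List.prod_cons]
    simp
  have h0 : ∀ k, k ≠ 0 → D k = 0 := fun k hk =>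
    hX.altSum_eq_zero _ (Fin.pos_of_ne_zero hk) (by simp [hk])
  have h1 : ∑ k, g k * D k = altSum X id := by
    rw [Finset.sum_eq_single 0 (fun k _ hk => by rw [h0 k hk, mul_zero])
      (by simp), hg, one_mul]
    simp only [D]
    congr 1
    exact Function.update_eq_self 0 id
  rw [← h1]
  simp_rw [hD, Finset.mul_sum, ← mul_assoc]
  rw [Finset.sum_comm]
  simp_rw [← Finset.sum_mul, hXg]
  rw [Finset.sum_eq_single 0 (fun k _ hk => by rw [if_neg hk, zero_mul])
    (by simp), if_pos rfl]
  congr 1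
  simp only [z, altSum]
  rw [sum_perm_fixing]
  refine Finset.sum_congr rfl fun e _ => ?_
  rw [Equiv.Perm.sign_extendDomain]
  simp_rw [← Fin.succAbove_zero_apply, extendDomain_succAbove, id]

theorem IsExchange.castSucc {N : ℕ} {X : Fin (N + 1) → Fin (N + 1) → Fin (N + 1) → S}
    (hX : IsExchange X) :
    IsExchange fun (p i j : Fin N) => X p.castSucc i.castSucc j.castSucc where
  same p q hpq _ _ _ := hX.same p.castSucc q.castSucc hpq _ _ _
  swap p q hpq _ _ _ _ := hX.swap p.castSucc q.castSucc hpq _ _ _ _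

theorem IsExchange.succ {N : ℕ} {X : Fin (N + 1) → Fin (N + 1) → Fin (N + 1) → S}
    (hX : IsExchange X) :
    IsExchange fun (p i j : Fin N) => X p.succ i.succ j.succ where
  same p q hpq _ _ _ := hX.same p.succ q.succ (by simp [hpq]) _ _ _
  swap p q hpq _ _ _ _ := hX.swap p.succ q.succ (by simp [hpq]) _ _ _ _

/-- An alternating sum whose last factors are triangularized by column operations. -/
theorem IsExchange.altSum_eq_prod_of_columns {N : ℕ} {X : Fin N → Fin N → Fin N → S}
    (hX : IsExchange X) (g : Fin N → Fin N → S) (δ : Fin N → S) (hg : ∀ p, g p p = 1)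
    (hg0 : ∀ p j, p < j → g p j = 0)
    (hXg : ∀ p i, i ≤ p → ∑ j, X p i j * g p j = if i = p then δ p else 0) :
    altSum X id = (List.ofFn δ).prod := by
  induction N with
  | zero => simp [altSum]
  | succ N ih =>
    rw [hX.altSum_last (g (Fin.last N)) (δ (Fin.last N)) (hg _)
      (fun i => hXg _ i (Fin.le_last i)),
      ih hX.castSucc (fun p j => g p.castSucc j.castSucc) (fun p => δ p.castSucc)
        (fun p => hg _) (fun p j h => hg0 _ _ h) ?_, List.ofFn_succ_last, List.prod_append]
    · simp
    · intro p i h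
      have := hXg p.castSucc i.castSucc h
      rw [Fin.sum_univ_castSucc, hg0 _ _ (Fin.castSucc_lt_last p), mul_zero, add_zero] at this
      simpa using this

/-- An alternating sum whose first factors are triangularized by row operations. -/
theorem IsExchange.altSum_eq_prod_of_rows {N : ℕ} {X : Fin N → Fin N → Fin N → S}
    (hX : IsExchange X) (g : Fin N → Fin N → S) (δ : Fin N → S) (hg : ∀ p, g p p = 1)
    (hg0 : ∀ p j, j < p → g p j = 0)
    (hXg : ∀ p i, p ≤ i → ∑ j, g p j * X p i j = if i = p then δ p else 0) :
    altSum X id = (List.ofFn δ).prod := by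
  induction N with
  | zero => simp [altSum]
  | succ N ih =>
    rw [hX.altSum_zero (g 0) (δ 0) (hg _) (fun i => hXg _ i (Fin.zero_le i)),
      ih hX.succ (fun p j => g p.succ j.succ) (fun p => δ p.succ)
        (fun p => hg _) (fun p j h => hg0 _ _ (by simpa using h)) ?_, List.ofFn_succ,
      List.prod_cons]
    intro p i h
    have := hXg p.succ i.succ (by simpa using h)
    rw [Fin.sum_univ_succ, hg0 _ _ (Fin.succ_pos p), zero_mul, zero_add] at this
    simpa using this

end AlternatingSums

/-! ### Inverses of unitriangular matrices -/

section Triangular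

variable {S : Type*} [Ring S] {ι : Type*} [Fintype ι] [DecidableEq ι]

/-- A nonzero entry of `N` strictly lowers the weight, so a path of length `k` from `i` to `j` needs
`w j + k ≤ w i`. -/
theorem strict_pow_apply {N : Matrix ι ι S} (w : ι → ℕ) (hN : ∀ i j, w i ≤ w j → N i j = 0)
    (k : ℕ) (i j : ι) (h : w i < w j + k) : (N ^ k) i j = 0 := by
  induction k generalizing i with
  | zero =>
    rw [pow_zero, Matrix.one_apply_ne]
    rintro rfl
    omega
  | succ k ih =>
    rw [pow_succ', Matrix.mul_apply]
    refine Finset.sum_eq_zero fun l _ => ?_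
    by_cases hl : w i ≤ w l
    · rw [hN _ _ hl, zero_mul]
    · rw [ih l (by omega), mul_zero]

/-- A unitriangular matrix has a unitriangular inverse. The weight `w` tells which indices are
below which. -/
theorem exists_unitriangular_inverse {U : Matrix ι ι S} (w : ι → ℕ) (hw : Function.Injective w)
    (h1 : ∀ i, U i i = 1) (h0 : ∀ i j, w i < w j → U i j = 0) :
    ∃ V : Matrix ι ι S, U * V = 1 ∧ V * U = 1 ∧ (∀ i, V i i = 1) ∧
      ∀ i j, w i < w j → V i j = 0 := by
  have hN : ∀ i j, w i ≤ w j → (1 - U) i j = 0 := by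
    intro i j hij
    rcases hij.lt_or_eq with h | h
    · rw [Matrix.sub_apply, h0 _ _ h, Matrix.one_apply_ne (by rintro rfl; omega), sub_zero]
    · rw [hw h, Matrix.sub_apply, h1, Matrix.one_apply_eq, sub_self]
  obtain ⟨K, hK⟩ : ∃ K, ∀ i, w i < K := ⟨∑ i, w i + 1, fun i =>
    Nat.lt_succ_of_le (Finset.single_le_sum (f := w) (fun _ _ => Nat.zero_le _)
      (Finset.mem_univ i))⟩
  have hpow : (1 - U) ^ K = 0 := by
    ext i j
    exact strict_pow_apply w hN K i j (by have := hK i; omega)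
  -- The Neumann series of `U = 1 - (1 - U)` stops because `1 - U` is nilpotent.
  refine ⟨∑ k ∈ Finset.range K, (1 - U) ^ k, ?_, ?_, ?_, ?_⟩
  · have := mul_neg_geom_sum (1 - U) K
    rwa [hpow, sub_sub_cancel, sub_zero] at this
  · have := geom_sum_mul_neg (1 - U) K
    rwa [hpow, sub_sub_cancel, sub_zero] at this
  · intro i
    rw [Matrix.sum_apply, Finset.sum_eq_single 0]
    · simp
    · intro k _ hk
      exact strict_pow_apply w hN k i i (by omega)
    · intro h
      have := hK i
      simp at h
      omega
  · intro i j hij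
    rw [Matrix.sum_apply]
    exact Finset.sum_eq_zero fun k _ => strict_pow_apply w hN k i j (by omega)

end Triangular

/-! ### Gauss decomposition by quasideterminants -/

section Gauss

variable {S : Type} [Ring S] {N : ℕ}

/-- The `r × r` submatrix in the upper left corner. -/
def corner (X : Matrix (Fin N) (Fin N) S) (r : ℕ) (hr : r ≤ N) : Matrix (Fin r) (Fin r) S :=
  X.submatrix (Fin.castLE hr) (Fin.castLE hr)

/-- The quasideterminants of the leading submatrices. -/
noncomputable def pivot (X : Matrix (Fin N) (Fin N) S) (i : Fin N) : S :=
  quasideterminant (corner X (i + 1) i.isLt) (Fin.last i) (Fin.last i)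

theorem pivot_eq (X : Matrix (Fin N) (Fin N) S) (i : Fin N) :
    pivot X i = X i i - ∑ a : Fin i, ∑ b : Fin i, X i (a.castLE i.isLt.le) *
      Ring.inverse (corner X i i.isLt.le) a b * X (b.castLE i.isLt.le) i := by
  unfold pivot quasideterminant
  simp only [Fin.succAbove_last]
  rfl

theorem sum_eq_sum_castLE_add (i : Fin N) (f : Fin N → S) (hf : ∀ k, i < k → f k = 0) :
    ∑ k, f k = ∑ k : Fin i, f (k.castLE i.isLt.le) + f i := by
  have h : ∑ k, f k = ∑ k : Fin (i + 1), f (k.castLE i.isLt) := by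
    symm
    refine Finset.sum_of_injOn (Fin.castLE i.isLt) (Fin.castLE_injective _).injOn
      (by simp) ?_ (by simp)
    intro k _ hk
    refine hf k (lt_of_not_ge fun hki => hk ⟨⟨k, Nat.lt_succ_of_le hki⟩, by simp, rfl⟩)
  rw [h, Fin.sum_univ_castSucc]
  rfl

/-- The columns which triangularize `X` from the right. -/
noncomputable def colOp (X : Matrix (Fin N) (Fin N) S) : Matrix (Fin N) (Fin N) S :=
  Matrix.of fun k j => if h : k < j then
      -∑ b : Fin j, Ring.inverse (corner X j j.isLt.le) ⟨k, h⟩ b * X (b.castLE j.isLt.le) j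
    else if k = j then 1 else 0

/-- The rows which triangularize `X` from the left. -/
noncomputable def rowOp (X : Matrix (Fin N) (Fin N) S) : Matrix (Fin N) (Fin N) S :=
  Matrix.of fun i k => if h : k < i then
      -∑ a : Fin i, X i (a.castLE i.isLt.le) * Ring.inverse (corner X i i.isLt.le) a ⟨k, h⟩
    else if i = k then 1 else 0

variable (X : Matrix (Fin N) (Fin N) S)

theorem colOp_self (i : Fin N) : colOp X i i = 1 := by simp [colOp]

theorem colOp_lower (i j : Fin N) (h : j < i) : colOp X i j = 0 := by
  simp [colOp, h.not_gt, h.ne']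

theorem colOp_castLE (j : Fin N) (k : Fin j) : colOp X (k.castLE j.isLt.le) j =
    -∑ b : Fin j, Ring.inverse (corner X j j.isLt.le) k b * X (b.castLE j.isLt.le) j := by
  have : k.castLE j.isLt.le < j := k.isLt
  simp only [colOp, Matrix.of_apply, dif_pos this]
  rfl

theorem rowOp_self (i : Fin N) : rowOp X i i = 1 := by simp [rowOp]

theorem rowOp_upper (i j : Fin N) (h : i < j) : rowOp X i j = 0 := by
  simp [rowOp, h.not_gt, h.ne]

theorem rowOp_castLE (i : Fin N) (k : Fin i) : rowOp X i (k.castLE i.isLt.le) =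
    -∑ a : Fin i, X i (a.castLE i.isLt.le) * Ring.inverse (corner X i i.isLt.le) a k := by
  have : k.castLE i.isLt.le < i := k.isLt
  simp only [rowOp, Matrix.of_apply, dif_pos this]
  rfl

variable {X}

/-- Column `i` of `colOp X` is `(-M⁻¹ c, 1, 0)`, where `M` is the preceding corner and `c` the part
of column `i` of `X` above the diagonal; pairing it with row `i` gives the Schur complement. -/
theorem mul_colOp_self (i : Fin N) : (X * colOp X) i i = pivot X i := by
  rw [Matrix.mul_apply, sum_eq_sum_castLE_add i _ fun k hk => by rw [colOp_lower X k i hk, mul_zero],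
    colOp_self, pivot_eq, mul_one, add_comm, sub_eq_add_neg, ← Finset.sum_neg_distrib]
  congr 1
  refine Finset.sum_congr rfl fun k _ => ?_
  rw [colOp_castLE, mul_neg, Finset.mul_sum]
  simp only [mul_assoc]

/-- Row `i` of `M M⁻¹` is a unit vector, so the correction term cancels the entry `X i j`. -/
theorem mul_colOp_upper (hX : ∀ r hr, IsUnit (corner X r hr)) (i j : Fin N) (h : i < j) :
    (X * colOp X) i j = 0 := by
  rw [Matrix.mul_apply, sum_eq_sum_castLE_add j _ fun k hk => by rw [colOp_lower X k j hk, mul_zero],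
    colOp_self, mul_one]
  simp_rw [colOp_castLE, mul_neg, Finset.sum_neg_distrib, Finset.mul_sum]
  rw [Finset.sum_comm]
  simp_rw [← mul_assoc, ← Finset.sum_mul]
  have key : ∀ b : Fin j, ∑ a : Fin j, X i (a.castLE j.isLt.le) *
      Ring.inverse (corner X j j.isLt.le) a b = if (⟨i, h⟩ : Fin j) = b then 1 else 0 := by
    intro b
    have := congrFun₂ (Ring.mul_inverse_cancel (corner X j j.isLt.le) (hX j j.isLt.le))
      (⟨i, h⟩ : Fin j) b
    rw [Matrix.mul_apply, Matrix.one_apply] at this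
    exact this
  simp_rw [key]
  rw [Finset.sum_eq_single (⟨i, h⟩ : Fin j) (fun b _ hb => by rw [if_neg hb.symm, zero_mul])
    (by simp), if_pos rfl, one_mul]
  exact neg_add_cancel _

theorem rowOp_mul_lower (hX : ∀ r hr, IsUnit (corner X r hr)) (i j : Fin N) (h : j < i) :
    (rowOp X * X) i j = 0 := by
  rw [Matrix.mul_apply, sum_eq_sum_castLE_add i _ fun k hk => by rw [rowOp_upper X i k hk, zero_mul],
    rowOp_self, one_mul]
  simp_rw [rowOp_castLE, neg_mul, Finset.sum_neg_distrib, Finset.sum_mul]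
  rw [Finset.sum_comm]
  simp_rw [mul_assoc, ← Finset.mul_sum]
  have key : ∀ b : Fin i, ∑ a : Fin i, Ring.inverse (corner X i i.isLt.le) b a *
      X (a.castLE i.isLt.le) j = if b = (⟨j, h⟩ : Fin i) then 1 else 0 := by
    intro b
    have := congrFun₂ (Ring.inverse_mul_cancel (corner X i i.isLt.le) (hX i i.isLt.le)) b
      (⟨j, h⟩ : Fin i)
    rw [Matrix.mul_apply, Matrix.one_apply] at this
    exact this
  simp_rw [key]
  rw [Finset.sum_eq_single (⟨j, h⟩ : Fin i) (fun b _ hb => by rw [if_neg hb, mul_zero])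
    (by simp), if_pos rfl, mul_one]
  exact neg_add_cancel _

/-- Triangularization by rows and columns together diagonalizes. -/
theorem rowOp_mul_mul_colOp (hX : ∀ r hr, IsUnit (corner X r hr)) :
    rowOp X * X * colOp X = Matrix.diagonal (pivot X) := by
  ext i j
  rcases lt_trichotomy i j with h | rfl | h
  · rw [Matrix.diagonal_apply_ne _ h.ne, mul_assoc, Matrix.mul_apply]
    refine Finset.sum_eq_zero fun k _ => ?_
    rcases lt_or_ge i k with h' | h'
    · rw [rowOp_upper X i k h', zero_mul]
    · rw [mul_colOp_upper hX k j (h'.trans_lt h), mul_zero]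
  · rw [Matrix.diagonal_apply_eq, mul_assoc, Matrix.mul_apply, Finset.sum_eq_single i, rowOp_self,
      one_mul, mul_colOp_self]
    · intro k _ hk
      rcases lt_or_gt_of_ne hk with h' | h'
      · rw [mul_colOp_upper hX k i h', mul_zero]
      · rw [rowOp_upper X i k h', zero_mul]
    · simp
  · rw [Matrix.diagonal_apply_ne _ h.ne', Matrix.mul_apply]
    refine Finset.sum_eq_zero fun k _ => ?_
    rcases lt_or_ge k i with h' | h'
    · rw [rowOp_mul_lower hX i k h', zero_mul]
    · rw [colOp_lower X k j (h.trans_le h'), mul_zero]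

theorem isUnit_of_isUnit_diagonal {ι : Type*} [Fintype ι] [DecidableEq ι] {v : ι → S}
    (h : IsUnit (Matrix.diagonal v)) (i : ι) : IsUnit (v i) := by
  obtain ⟨u, hu⟩ := h
  have h1 := congrFun₂ u.mul_inv i i
  have h2 := congrFun₂ u.inv_mul i i
  rw [hu, Matrix.diagonal_mul, Matrix.one_apply_eq] at h1
  rw [hu, Matrix.mul_diagonal, Matrix.one_apply_eq] at h2
  exact ⟨⟨v i, _, h1, h2⟩, rfl⟩

/-- The Gauss decomposition of a matrix all whose leading submatrices are invertible. -/
theorem gauss_decomposition (hX : ∀ r hr, IsUnit (corner X r hr)) :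
    (∀ i, IsUnit (pivot X i)) ∧
    ∃ F E : Matrix (Fin N) (Fin N) S,
      (∀ i, F i i = 1) ∧ (∀ i j, i < j → F i j = 0) ∧
      (∀ i, E i i = 1) ∧ (∀ i j, j < i → E i j = 0) ∧
      rowOp X * F = 1 ∧ F * rowOp X = 1 ∧ E * colOp X = 1 ∧ colOp X * E = 1 ∧
      X = F * Matrix.diagonal (pivot X) * E := by
  obtain ⟨F, hF1, hF2, hF3, hF4⟩ := exists_unitriangular_inverse (U := rowOp X)
    (fun i : Fin N => (i : ℕ)) Fin.val_injective (rowOp_self X) (rowOp_upper X)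
  -- The weight `N - i` reverses the order, so the upper triangular `colOp X` fits the same lemma.
  obtain ⟨E, hE1, hE2, hE3, hE4⟩ := exists_unitriangular_inverse (U := colOp X)
    (fun i : Fin N => N - (i : ℕ)) (fun i j h => by ext; simp at h; omega) (colOp_self X)
    (fun i j h => colOp_lower X i j (by rw [Fin.lt_def]; omega))
  have hXd := rowOp_mul_mul_colOp hX
  refine ⟨fun i => ?_, F, E, hF3, hF4, hE3, fun i j h => hE4 i j ?_, hF1, hF2, hE2, hE1, ?_⟩
  · have hN : IsUnit X := hX N le_rfl
    have hG : IsUnit (colOp X) := ⟨⟨_, E, hE1, hE2⟩, rfl⟩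
    have hH : IsUnit (rowOp X) := ⟨⟨_, F, hF1, hF2⟩, rfl⟩
    exact isUnit_of_isUnit_diagonal (hXd ▸ (hH.mul hN).mul hG) i
  · have : (j : ℕ) < i := h
    omega
  · rw [← hXd, mul_assoc, mul_assoc, mul_assoc, hE1, mul_one, ← mul_assoc, hF2, one_mul]

/-- The lower right entries of the inverse are triangularized from the left by rows of `E`. -/
theorem unitriangular_mul_inverse {F E : Matrix (Fin N) (Fin N) S}
    (hX : ∀ r hr, IsUnit (corner X r hr)) (hF : rowOp X * F = 1)
    (hXd : X = F * Matrix.diagonal (pivot X) * E) (i j : Fin N)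
    (h : i ≤ j) : (E * Ring.inverse X) i j = if j = i then Ring.inverse (pivot X i) else 0 := by
  have hN : IsUnit X := hX N le_rfl
  have hp := (gauss_decomposition hX).1
  -- Here `rowOp X` is `F⁻¹`, so this is `E X⁻¹ = D⁻¹ F⁻¹`.
  have key : E * Ring.inverse X = Matrix.diagonal (fun i => Ring.inverse (pivot X i)) * rowOp X := by
    have h2 : rowOp X * X = Matrix.diagonal (pivot X) * E := by
      have := congrArg (rowOp X * ·) hXd
      simpa only [← mul_assoc, hF, one_mul] using this
    have h1 : Matrix.diagonal (fun i => Ring.inverse (pivot X i)) * rowOp X * X = E := by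
      rw [mul_assoc, h2, ← mul_assoc, Matrix.diagonal_mul_diagonal]
      simp_rw [Ring.inverse_mul_cancel _ (hp _)]
      rw [Matrix.diagonal_one, one_mul]
    conv_lhs => rw [← h1, mul_assoc, Ring.mul_inverse_cancel _ hN, mul_one]
  rw [key, Matrix.diagonal_mul]
  rcases h.eq_or_lt with rfl | h
  · rw [rowOp_self, mul_one, if_pos rfl]
  · rw [rowOp_upper X i j h, mul_zero, if_neg h.ne']

end Gauss

/-! ### Reduction modulo powers of `h` and invertibility -/

section Residue

variable {B : Type} [Ring B] [Algebra Base B]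

/-- The projection of the `h`-adic completion to `B / h ^ k B`. -/
noncomputable def residue (k : ℕ) : Completion B →ₐ[Base] B ⧸ hIdeal B k :=
  (Pi.evalAlgHom Base (fun k : ℕ => B ⧸ hIdeal B k) k).comp (coherent B).val

theorem Completion.ext {x y : Completion B} (h : ∀ k, residue k x = residue k y) : x = y :=
  Subtype.ext (funext h)

theorem residue_hSum (a : ℕ → Completion B) (k : ℕ) :
    residue k (hSum a) = ∑ s ∈ Finset.range k, (hbar ^ s) • residue k (a s) := rfl

theorem smul_quotient_eq_zero {k : ℕ} {r : Base} (hr : hbar ^ k ∣ r) (x : B ⧸ hIdeal B k) :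
    r • x = 0 := by
  obtain ⟨r, rfl⟩ := hr
  rw [mul_comm, mul_smul, hbar_pow_smul_quotient, smul_zero]

/-- A matrix of power series over the completion which is congruent to `1` modulo `h` is
invertible. -/
theorem isUnit_one_add_hbar_smul {ι : Type*} [Fintype ι] [DecidableEq ι]
    (Z : Matrix ι ι (PowerSeries (Completion B))) : IsUnit (1 + hbar • Z) := by
  -- The reductions modulo `h ^ k` are jointly injective, and in each of them the geometric series
  -- is finite.
  let Φ (k : ℕ) : Matrix ι ι (PowerSeries (Completion B)) →+*
      Matrix ι ι (PowerSeries (B ⧸ hIdeal B k)) :=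
    (PowerSeries.map (residue k : Completion B →ₐ[Base] B ⧸ hIdeal B k).toRingHom).mapMatrix
  have hΦ : ∀ {x y}, (∀ k, Φ k x = Φ k y) → x = y := by
    intro x y h
    ext i j c
    refine Completion.ext fun k => ?_
    simpa [Φ] using congrArg (PowerSeries.coeff c) (congrFun₂ (h k) i j)
  have hsmul : ∀ k (r : Base) x, Φ k (r • x) = r • Φ k x := by
    intro k r x
    ext i j c
    simp [Φ]
  let Y : Matrix ι ι (PowerSeries (Completion B)) :=
    Matrix.of fun i j => PowerSeries.mk fun c => hSum fun s => PowerSeries.coeff c (((-Z) ^ s) i j)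
  have hY : ∀ k, Φ k Y = ∑ s ∈ Finset.range k, (hbar • Φ k (-Z)) ^ s := by
    intro k
    simp_rw [smul_pow, ← map_pow, ← hsmul]
    ext i j c
    simp [Φ, Y, Matrix.sum_apply, residue_hSum]
  have hpow : ∀ k, (hbar • Φ k (-Z)) ^ k = 0 := by
    intro k
    rw [smul_pow]
    ext i j c
    simp [hbar_pow_smul_quotient]
  have h1 : ∀ k, Φ k (1 + hbar • Z) = 1 - hbar • Φ k (-Z) := by
    intro k
    rw [map_add, map_one, hsmul, map_neg, smul_neg, sub_neg_eq_add]
  refine ⟨⟨1 + hbar • Z, Y, hΦ fun k => ?_, hΦ fun k => ?_⟩, rfl⟩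
  · rw [map_mul, h1, hY, mul_neg_geom_sum, hpow, sub_zero, map_one]
  · rw [map_mul, h1, hY, geom_sum_mul_neg, hpow, sub_zero, map_one]

end Residue

/-! ### The image of the variable under a shift -/

section Node

/-- The image of the variable under `u ↦ u - c h`, as a series in `u` for `ε = plus` and in `u⁻¹`
for `ε = minus`. -/
noncomputable def node (ε : YSign) (c : ℤ) : PowerSeries Base :=
  match ε with
  | .plus => PowerSeries.X - PowerSeries.C (c * hbar)
  | .minus => PowerSeries.X * PowerSeries.invOfUnit (1 - PowerSeries.C (c * hbar) * PowerSeries.X) 1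

theorem node_minus_mul (c : ℤ) :
    node .minus c * (1 - PowerSeries.C (c * hbar) * PowerSeries.X) = PowerSeries.X := by
  rw [node, mul_assoc, mul_comm (PowerSeries.invOfUnit _ _), PowerSeries.mul_invOfUnit, mul_one]
  simp

theorem isUnit_one_sub (r : Base) : IsUnit (1 - PowerSeries.C r * PowerSeries.X : PowerSeries Base) :=
  PowerSeries.isUnit_iff_constantCoeff.2 (by simp)

theorem node_plus_sub (c d : ℤ) :
    node .plus c - node .plus d = PowerSeries.C (((d - c : ℤ) : Base) * hbar) := by
  simp only [node, Int.cast_sub, sub_mul, map_sub]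
  ring

/-- This is `1/(u - d h) - 1/(u - c h)` over a common denominator; clearing the unit denominators
turns it into a polynomial identity. -/
theorem node_minus_sub (c d : ℤ) : node .minus d - node .minus c =
    PowerSeries.C (((d - c : ℤ) : Base) * hbar) * (node .minus c * node .minus d) := by
  have hc := node_minus_mul c
  have hd := node_minus_mul d
  refine (isUnit_one_sub (c * hbar)).mul_right_cancel ((isUnit_one_sub (d * hbar)).mul_right_cancel ?_)
  simp only [Int.cast_sub, sub_mul, map_sub]
  generalize PowerSeries.C ((c : Base) * hbar) = x at *
  generalize PowerSeries.C ((d : Base) * hbar) = y at *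
  generalize node .minus c = p at *
  generalize node .minus d = q at *
  linear_combination (1 - x * PowerSeries.X) * hd - (1 - y * PowerSeries.X) * hc
    - (y - x) * (p * (1 - x * PowerSeries.X) * hd + PowerSeries.X * hc)

theorem coeff_node_plus_pow (c : ℤ) (a N : ℕ) : PowerSeries.coeff N (node .plus c ^ a) =
    (-(c * hbar)) ^ (a - N) * (a.choose N : Base) := by
  have : node .plus c = ((Polynomial.X + Polynomial.C (-(c * hbar)) : Polynomial Base) :
      PowerSeries Base) := by
    rw [node]
    generalize (c : Base) * hbar = r
    simp [sub_eq_add_neg]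
  rw [this, ← Polynomial.coe_pow, Polynomial.coeff_coe, Polynomial.coeff_X_add_C_pow]

theorem coeff_node_minus_pow (c : ℤ) (a N : ℕ) : PowerSeries.coeff N (node .minus c ^ a) =
    if a ≤ N then (c * hbar) ^ (N - a) * ((N - 1).choose (N - a) : Base) else 0 := by
  let q (a : ℕ) : PowerSeries Base := PowerSeries.mk fun N =>
    if a ≤ N then (c * hbar) ^ (N - a) * ((N - 1).choose (N - a) : Base) else 0
  suffices h : node .minus c ^ a = q a by rw [h]; simp [q]
  induction a with
  | zero =>
    ext N
    rcases N with _ | N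
    · simp [q]
    · simp [q, PowerSeries.coeff_one]
  | succ a ih =>
    -- Clearing the denominator of `node` reduces the induction step to Pascal's rule. The truncated
    -- `N - 1` is right at `N = 0`, where the only nonzero coefficient is that of `a = 0`.
    refine (isUnit_one_sub (c * hbar)).mul_right_cancel ?_
    rw [pow_succ, mul_assoc, node_minus_mul, ih, mul_sub, mul_one, ← mul_assoc,
      mul_comm _ (PowerSeries.C _)]
    ext N
    rcases N with _ | N
    · simp [q]
    · rw [PowerSeries.coeff_succ_mul_X, map_sub, PowerSeries.coeff_succ_mul_X,
        PowerSeries.coeff_C_mul]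
      simp only [q, PowerSeries.coeff_mk]
      rcases lt_trichotomy a N with h | rfl | h
      · obtain ⟨s, rfl⟩ := Nat.exists_eq_add_of_lt h
        rw [if_pos (by omega), if_pos (by omega), if_pos (by omega),
          show a + s + 1 - a = s + 1 by omega, show a + s + 1 + 1 - (a + 1) = s + 1 by omega,
          show a + s + 1 - (a + 1) = s by omega, Nat.add_sub_cancel, Nat.add_sub_cancel,
          Nat.choose_succ_succ]
        push_cast
        ring
      · simp
      · rw [if_neg (by omega), if_neg (by omega), if_neg (by omega)]
        simp

/-- The coefficients of `u ^ N` are divisible by `h ^ (a - N)`. -/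
def HDivisible (a : ℕ) (f : PowerSeries Base) : Prop :=
  ∀ N, hbar ^ (a - N) ∣ PowerSeries.coeff N f

theorem HDivisible.mul {a b : ℕ} {f g : PowerSeries Base} (hf : HDivisible a f)
    (hg : HDivisible b g) : HDivisible (a + b) (f * g) := by
  intro N
  rw [PowerSeries.coeff_mul]
  refine Finset.dvd_sum fun p hp => ?_
  rw [Finset.HasAntidiagonal.mem_antidiagonal] at hp
  refine (pow_dvd_pow hbar ?_).trans ((pow_add hbar _ _).dvd.trans
    (mul_dvd_mul (hf p.1) (hg p.2)))
  omega

theorem HDivisible.pow {a : ℕ} {f : PowerSeries Base} (hf : HDivisible a f) (b : ℕ) :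
    HDivisible (b * a) (f ^ b) := by
  induction b with
  | zero => intro N; simp
  | succ b ih => rw [pow_succ, add_mul, one_mul]; exact ih.mul hf

/-- The constant term is a multiple of `h`. Hence high powers of `node` contribute nothing to a
fixed coefficient modulo `h ^ k`. -/
theorem hDivisible_node (ε : YSign) (c : ℤ) : HDivisible 1 (node ε c) := by
  rintro (_ | N)
  · cases ε <;> simp [node]
  · simp

theorem hDivisible_node_pow_mul (ε : YSign) (c d : ℤ) (a b : ℕ) :
    HDivisible (a + b) (node ε c ^ a * node ε d ^ b) := by
  simpa using ((hDivisible_node ε c).pow a).mul ((hDivisible_node ε d).pow b)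

end Node

/-! ### The substitution `u ↦ u - c h` -/

section Shift

variable {m n : ℕ}

theorem smul_node_eq_zero {B : Type} [Ring B] [Algebra Base B] (ε : YSign) (c d : ℤ)
    {N k a b : ℕ} (h : N + k ≤ a + b) (x : B ⧸ hIdeal B k) :
    PowerSeries.coeff N (node ε c ^ a * node ε d ^ b) • x = 0 :=
  smul_quotient_eq_zero ((pow_dvd_pow _ (by omega)).trans (hDivisible_node_pow_mul ε c d a b N)) x

theorem smul_node_pow_eq_zero {B : Type} [Ring B] [Algebra Base B] (ε : YSign) (c : ℤ)
    {N k a : ℕ} (h : N + k ≤ a) (x : B ⧸ hIdeal B k) :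
    PowerSeries.coeff N (node ε c ^ a) • x = 0 := by
  simpa using smul_node_eq_zero ε c 0 (b := 0) h x

/-- Describes both signs uniformly as `f` evaluated at `node`, with a free cutoff `M` so that
several such sums can share one range. -/
theorem residue_coeff_shift (ε : YSign) (c : ℤ) (f : Series m n) {k N M : ℕ} (hM : N + k < M) :
    residue k (PowerSeries.coeff N (shift ε c f)) =
      ∑ a ∈ Finset.range M, PowerSeries.coeff N (node ε c ^ a) •
        residue k (PowerSeries.coeff a f) := by
  cases ε with
  | plus =>
    rw [← Finset.sum_subset (Finset.range_mono hM.le) fun a _ ha =>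
      smul_node_pow_eq_zero _ _ (by simpa using ha) _, Finset.sum_range_add,
      Finset.sum_eq_zero, zero_add]
    · simp only [shift, PowerSeries.coeff_mk, residue_hSum]
      refine Finset.sum_congr rfl fun s _ => ?_
      rw [map_zsmul, coeff_node_plus_pow, ← Int.cast_smul_eq_zsmul Base, smul_smul,
        Nat.add_sub_cancel_left, Nat.choose_symm_add]
      congr 1
      push_cast
      rw [neg_mul_eq_neg_mul, mul_pow]
      ring
    · intro a ha
      rw [coeff_node_plus_pow, Nat.choose_eq_zero_of_lt (Finset.mem_range.1 ha)]
      simp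
  | minus =>
    have hMN : N + 1 ≤ M := by omega
    rw [← Finset.sum_subset (Finset.range_mono hMN) fun a _ ha => by
      rw [coeff_node_minus_pow, if_neg (by simp at ha; omega), zero_smul]]
    simp only [shift, PowerSeries.coeff_mk, map_sum]
    rw [Finset.Nat.sum_antidiagonal_eq_sum_range_succ_mk]
    refine Finset.sum_congr rfl fun a ha => ?_
    have haN : a ≤ N := by simp at ha; omega
    rw [map_smul, map_zsmul, coeff_node_minus_pow, if_pos haN, ← Int.cast_smul_eq_zsmul Base,
      smul_smul, Nat.add_sub_cancel' haN]
    congr 1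
    push_cast
    rw [mul_pow]
    ring

theorem residue_coeff_shift_mul_shift (ε : YSign) (c d : ℤ) (f g : Series m n) {k N M : ℕ}
    (hM : N + k < M) :
    residue k (PowerSeries.coeff N (shift ε c f * shift ε d g)) =
      ∑ a ∈ Finset.range M, ∑ b ∈ Finset.range M,
        PowerSeries.coeff N (node ε c ^ a * node ε d ^ b) •
          residue k (PowerSeries.coeff a f * PowerSeries.coeff b g) := by
  rw [PowerSeries.coeff_mul, map_sum]
  have h : ∀ p ∈ Finset.HasAntidiagonal.antidiagonal N, residue k (PowerSeries.coeff p.1 (shift ε c f) *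
      PowerSeries.coeff p.2 (shift ε d g)) = ∑ a ∈ Finset.range M, ∑ b ∈ Finset.range M,
        (PowerSeries.coeff p.1 (node ε c ^ a) * PowerSeries.coeff p.2 (node ε d ^ b)) •
          residue k (PowerSeries.coeff a f * PowerSeries.coeff b g) := by
    intro p hp
    rw [Finset.HasAntidiagonal.mem_antidiagonal] at hp
    rw [map_mul, residue_coeff_shift ε c f (M := M) (by omega),
      residue_coeff_shift ε d g (M := M) (by omega), Finset.sum_mul_sum]
    simp only [smul_mul_smul_comm, map_mul]
  rw [Finset.sum_congr rfl h, Finset.sum_comm]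
  refine Finset.sum_congr rfl fun a _ => ?_
  rw [Finset.sum_comm]
  refine Finset.sum_congr rfl fun b _ => ?_
  rw [PowerSeries.coeff_mul, Finset.sum_smul]

/-- The scalars commute although the coefficients do not, so both orders of a product are expanded
with the same weights and can be subtracted. -/
theorem residue_coeff_shift_mul_shift' (ε : YSign) (c d : ℤ) (f g : Series m n) {k N M : ℕ}
    (hM : N + k < M) :
    residue k (PowerSeries.coeff N (shift ε d g * shift ε c f)) =
      ∑ a ∈ Finset.range M, ∑ b ∈ Finset.range M,
        PowerSeries.coeff N (node ε c ^ a * node ε d ^ b) •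
          residue k (PowerSeries.coeff b g * PowerSeries.coeff a f) := by
  rw [residue_coeff_shift_mul_shift ε d c g f hM, Finset.sum_comm]
  simp only [mul_comm (node ε d ^ _)]

theorem series_ext {f g : Series m n}
    (h : ∀ k N, residue k (PowerSeries.coeff N f) = residue k (PowerSeries.coeff N g)) : f = g := by
  ext N
  exact Completion.ext fun k => h k N

/-- The substitution `u ↦ u - c h` is a ring homomorphism. -/
noncomputable def shiftHom (ε : YSign) (c : ℤ) : Series m n →+* Series m n where
  toFun := shift ε c
  map_one' := by
    refine series_ext fun k N => ?_
    rw [residue_coeff_shift ε c 1 (Nat.lt_succ_self (N + k)), Finset.sum_range_succ']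
    simp [PowerSeries.coeff_one]
  map_mul' f g := by
    refine series_ext fun k N => ?_
    have hM := Nat.lt_succ_self (N + k)
    rw [residue_coeff_shift ε c _ hM, residue_coeff_shift_mul_shift ε c c f g hM]
    have h : ∀ a, PowerSeries.coeff N (node ε c ^ a) • residue k (PowerSeries.coeff a (f * g)) =
        ∑ b ∈ Finset.range (a + 1), PowerSeries.coeff N (node ε c ^ b * node ε c ^ (a - b)) •
          residue k (PowerSeries.coeff b f * PowerSeries.coeff (a - b) g) := by
      intro a
      rw [PowerSeries.coeff_mul, map_sum, Finset.Nat.sum_antidiagonal_eq_sum_range_succ_mk,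
        Finset.smul_sum]
      refine Finset.sum_congr rfl fun b hb => ?_
      rw [← pow_add, Nat.add_sub_cancel' (by simp at hb; omega)]
    simp_rw [h]
    rw [Finset.sum_range_diag_flip _ fun a b =>
      PowerSeries.coeff N (node ε c ^ a * node ε c ^ b) •
        residue k (PowerSeries.coeff a f * PowerSeries.coeff b g)]
    refine Finset.sum_congr rfl fun a _ => ?_
    -- The square exceeds the triangle only by terms with `a + b ≥ M`, which vanish modulo `h ^ k`.
    refine Finset.sum_subset (Finset.range_mono (Nat.sub_le _ _)) fun b _ hb => ?_
    exact smul_node_eq_zero _ _ _ (by simp at hb; omega) _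
  map_zero' := by
    refine series_ext fun k N => ?_
    rw [residue_coeff_shift ε c 0 (Nat.lt_succ_self (N + k))]
    simp
  map_add' f g := by
    refine series_ext fun k N => ?_
    have hM := Nat.lt_succ_self (N + k)
    simp only [map_add, residue_coeff_shift ε c _ hM, smul_add, Finset.sum_add_distrib]

/-- The relation `(u - v) U(u, v) = Y(u, v)` between the coefficients of series in two variables. -/
def DividesDifference {A : Type*} [Ring A] (ε : YSign) (U Y : ℕ → ℕ → A) : Prop :=
  match ε with
  | .plus => ∀ a b, Y a b = (if a = 0 then 0 else U (a - 1) b) - (if b = 0 then 0 else U a (b - 1))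
  | .minus => (∀ a b, Y a b = U (a + 1) b - U a (b + 1)) ∧ (∀ b, U 0 b = 0) ∧ ∀ a, U a 0 = 0

/-- Under `u ↦ u - c h`, `v ↦ u - d h` the factor `u - v` becomes `(d - c) h`. -/
theorem DividesDifference.sum_eq {B : Type} [Ring B] [Algebra Base B] {ε : YSign} {k : ℕ}
    {U Y : ℕ → ℕ → B ⧸ hIdeal B k} (h : DividesDifference ε U Y) (c d : ℤ) {N M : ℕ}
    (hM : N + k < M) :
    ∑ a ∈ Finset.range M, ∑ b ∈ Finset.range M,
        PowerSeries.coeff N (node ε c ^ a * node ε d ^ b) • Y a b =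
      (((d - c : ℤ) : Base) * hbar) • ∑ a ∈ Finset.range M, ∑ b ∈ Finset.range M,
        PowerSeries.coeff N (node ε c ^ a * node ε d ^ b) • U a b := by
  obtain ⟨M, rfl⟩ : ∃ M', M = M' + 1 := ⟨M - 1, by omega⟩
  obtain ⟨e, he⟩ : ∃ e : ℕ → ℕ → Base,
      ∀ a b, e a b = PowerSeries.coeff N (node ε c ^ a * node ε d ^ b) := ⟨_, fun _ _ => rfl⟩
  -- With one index to spare in the cutoff, the boundary terms of the index shifts below vanish.
  have hz : ∀ a b, M ≤ a + b → ∀ x : B ⧸ hIdeal B k, e a b • x = 0 := fun a b hab x => by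
    rw [he]
    exact smul_node_eq_zero ε c d (by omega) x
  have hz1 : ∀ a, ∀ x : B ⧸ hIdeal B k, e a M • x = 0 := fun a => hz a M (by omega)
  have hz2 : ∀ b, ∀ x : B ⧸ hIdeal B k, e M b • x = 0 := fun b => hz M b (by omega)
  obtain ⟨r, hr⟩ : ∃ r, r = ((d - c : ℤ) : Base) * hbar := ⟨_, rfl⟩
  simp_rw [← he, ← hr, Finset.smul_sum, smul_smul]
  cases ε with
  | plus =>
    -- Multiplication by `node c - node d` on the weights; summation by parts transfers it to `U`.
    have hrec : ∀ a b, r * e a b = e (a + 1) b - e a (b + 1) := by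
      intro a b
      simp only [he, hr]
      rw [← PowerSeries.coeff_C_mul, ← node_plus_sub, ← map_sub]
      congr 1
      ring
    have e1 : ∑ a ∈ Finset.range (M + 1), ∑ b ∈ Finset.range (M + 1),
        e a b • (if a = 0 then 0 else U (a - 1) b) =
        ∑ a ∈ Finset.range (M + 1), ∑ b ∈ Finset.range (M + 1), e (a + 1) b • U a b := by
      rw [Finset.sum_range_succ', Finset.sum_range_succ
        (fun a => ∑ b ∈ Finset.range (M + 1), e (a + 1) b • U a b)]
      simp [fun b => hz (M + 1) b (by omega)]
    have e2 : ∑ a ∈ Finset.range (M + 1), ∑ b ∈ Finset.range (M + 1),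
        e a b • (if b = 0 then 0 else U a (b - 1)) =
        ∑ a ∈ Finset.range (M + 1), ∑ b ∈ Finset.range (M + 1), e a (b + 1) • U a b := by
      refine Finset.sum_congr rfl fun a _ => ?_
      rw [Finset.sum_range_succ', Finset.sum_range_succ (fun b => e a (b + 1) • U a b)]
      simp [hz a (M + 1) (by omega)]
    have h' : ∀ a b, Y a b = (if a = 0 then 0 else U (a - 1) b) -
      (if b = 0 then 0 else U a (b - 1)) := h
    simp_rw [h', smul_sub, Finset.sum_sub_distrib, e1, e2, hrec, sub_smul,
      Finset.sum_sub_distrib]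
  | minus =>
    obtain ⟨h, h1, h2⟩ := h
    have hrec : ∀ a b, r * e (a + 1) (b + 1) =
        e a (b + 1) - e (a + 1) b := by
      intro a b
      simp only [he, hr]
      have := node_minus_sub c d
      rw [← PowerSeries.coeff_C_mul, ← map_sub]
      congr 1
      linear_combination -(node .minus c ^ a * node .minus d ^ b) * this
    simp_rw [h _ _, smul_sub, Finset.sum_sub_distrib]
    -- The edges `U 0 b` and `U a 0` are not reached by `hrec`; their vanishing is what closes the
    -- summation by parts.
    have e1 : ∑ a ∈ Finset.range (M + 1), ∑ b ∈ Finset.range (M + 1), e a b • U (a + 1) b =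
        ∑ a ∈ Finset.range M, ∑ b ∈ Finset.range M, e a (b + 1) • U (a + 1) (b + 1) := by
      rw [Finset.sum_range_succ]
      simp [hz2, Finset.sum_range_succ', h2]
    have e2 : ∑ a ∈ Finset.range (M + 1), ∑ b ∈ Finset.range (M + 1), e a b • U a (b + 1) =
        ∑ a ∈ Finset.range M, ∑ b ∈ Finset.range M, e (a + 1) b • U (a + 1) (b + 1) := by
      rw [Finset.sum_range_succ']
      simp [hz1, Finset.sum_range_succ, h1]
    rw [e1, e2, ← Finset.sum_sub_distrib, Finset.sum_range_succ']
    simp [Finset.sum_range_succ' _ M, h1, h2, ← Finset.sum_sub_distrib, ← sub_smul, hrec]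

end Shift

/-! ### From the RTT relation to exchange relations -/

section ExchangeRelations

variable {m n : ℕ}

theorem parity_eq (i : Fin (m + n)) : parity i = 0 ∨ parity i = 1 := by
  unfold parity
  split_ifs <;> simp

theorem tensorT1_mul_tensorT2 (ε ε' : YSign) (a b : ℤ) (i j k l : Fin (m + n)) :
    (tensorT1 ε a).mul (tensorT2 ε' b) i j k l =
      (sgn ((parity i + parity j) * (parity k + parity l)) * sgn (parity i * parity j + parity j) *
        sgn (parity k * parity l + parity l)) • (tCoeff ε i j a * tCoeff ε' k l b) := by
  simp only [Tensor.mul, tensorT1, tensorT2]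
  rw [Finset.sum_eq_single j, Finset.sum_eq_single k]
  · rw [if_pos rfl, if_pos rfl, smul_mul_smul_comm, smul_smul]
    congr 1
    rcases parity_eq i with hi | hi <;> rcases parity_eq j with hj | hj <;>
      rcases parity_eq k with hk | hk <;> rcases parity_eq l with hl | hl <;>
      simp [hi, hj, hk, hl, sgn]
  · intro b _ hb
    simp [hb.symm]
  · simp
  · intro a _ ha
    simp [ha]
  · simp

theorem tensorT2_mul_tensorT1 (ε ε' : YSign) (a b : ℤ) (i j k l : Fin (m + n)) :
    (tensorT2 ε' b).mul (tensorT1 ε a) i j k l =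
      (sgn (parity i * parity j + parity j) * sgn (parity k * parity l + parity l)) •
        (tCoeff ε' k l b * tCoeff ε i j a) := by
  simp only [Tensor.mul, tensorT1, tensorT2]
  rw [Finset.sum_eq_single i, Finset.sum_eq_single l]
  · rw [if_pos rfl, if_pos rfl, smul_mul_smul_comm, smul_smul]
    congr 1
    rcases parity_eq i with hi | hi <;> rcases parity_eq j with hj | hj <;>
      rcases parity_eq k with hk | hk <;> rcases parity_eq l with hl | hl <;>
      simp [hi, hj, hk, hl, sgn]
  · intro b _ hb
    simp [hb]
  · simp
  · intro a _ ha
    simp [ha.symm]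
  · simp

theorem tensorP_mul (X : Tensor m n) (i j k l : Fin (m + n)) :
    (tensorP m n).mul X i j k l =
      (sgn (parity k) * sgn ((parity k + parity i) * (parity k + parity j))) • X k j i l := by
  simp only [Tensor.mul, tensorP]
  rw [Finset.sum_eq_single k, Finset.sum_eq_single i]
  · rw [if_pos ⟨rfl, rfl⟩, ← zsmul_eq_mul, smul_smul]
    congr 1
    rcases parity_eq i with hi | hi <;> rcases parity_eq j with hj | hj <;>
      rcases parity_eq k with hk | hk <;> rcases parity_eq l with hl | hl <;>
      simp [hi, hj, hk, hl, sgn]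
  · intro b _ hb
    simp [hb]
  · simp
  · intro a _ ha
    simp [ha.symm]
  · simp

theorem mul_tensorP (X : Tensor m n) (i j k l : Fin (m + n)) :
    X.mul (tensorP m n) i j k l =
      (sgn (parity j) * sgn ((parity k + parity j) * (parity l + parity j))) • X i l k j := by
  simp only [Tensor.mul, tensorP]
  rw [Finset.sum_eq_single l, Finset.sum_eq_single j]
  · rw [if_pos ⟨rfl, rfl⟩, ← (Int.cast_commute _ _).eq, ← zsmul_eq_mul, smul_smul]
    congr 1
    rcases parity_eq i with hi | hi <;> rcases parity_eq j with hj | hj <;>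
      rcases parity_eq k with hk | hk <;> rcases parity_eq l with hl | hl <;>
      simp [hi, hj, hk, hl, sgn]
  · intro b _ hb
    simp [hb]
  · simp
  · intro a _ ha
    simp [ha.symm]
  · simp

/-- The coefficient of `u ^ a` in `(t^ε_{ij}(u) - δ_{ij}) / h`. -/
noncomputable def reducedCoeff (ε : YSign) (i j : Fin (m + n)) (a : ℤ) : Free m n :=
  match ε with
  | .minus => if a < 0 then FreeAlgebra.ι Base (YSign.minus, i, j, (-a - 1).toNat) else 0
  | .plus => if 0 ≤ a then -FreeAlgebra.ι Base (YSign.plus, i, j, a.toNat) else 0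

theorem tCoeff_eq (ε : YSign) (i j : Fin (m + n)) (a : ℤ) :
    tCoeff ε i j a = (if a = 0 ∧ i = j then 1 else 0) + hbar • reducedCoeff ε i j a := by
  cases ε <;> simp [tCoeff, reducedCoeff, smul_ite]

/-- The coefficient of `u ^ a v ^ b` in `h⁻²` times the supercommutator of `t^ε_{ij}(u)` and
`t^ε_{kl}(v)`. -/
noncomputable def reducedBracket (ε : YSign) (i j k l : Fin (m + n)) (a b : ℤ) : Free m n :=
  sgn ((parity i + parity j) * (parity k + parity l)) •
    (reducedCoeff ε i j a * reducedCoeff ε k l b) - reducedCoeff ε k l b * reducedCoeff ε i j a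

/-- The constant term `δ_{ij}` drops out: when `i = j` the parity `ī + j̄` is even, so the sign is
`1` and scalars commute. -/
theorem smul_reducedBracket (ε : YSign) (i j k l : Fin (m + n)) (a b : ℤ) :
    hbar • (hbar • reducedBracket ε i j k l a b) =
      sgn ((parity i + parity j) * (parity k + parity l)) • (tCoeff ε i j a * tCoeff ε k l b) -
        tCoeff ε k l b * tCoeff ε i j a := by
  rw [tCoeff_eq ε i j, tCoeff_eq ε k l, reducedBracket]
  generalize reducedCoeff ε i j a = x
  generalize reducedCoeff ε k l b = y
  have h2 : ∀ (i : Fin (m + n)) q, sgn ((parity i + parity i) * q) = 1 := fun i q => by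
    rw [sgn, ← two_mul, mul_assoc, pow_mul]; simp
  have h3 : ∀ (i : Fin (m + n)) q, sgn (q * (parity i + parity i)) = 1 := fun i q => by
    rw [mul_comm, h2]
  by_cases hij : a = 0 ∧ i = j
  · obtain ⟨rfl, rfl⟩ := hij
    rw [h2, if_pos ⟨rfl, rfl⟩]
    split_ifs <;> simp only [one_smul, smul_sub, smul_add, mul_add, add_mul, mul_one, one_mul,
      smul_mul_assoc, mul_smul_comm, zero_add] <;> abel
  by_cases hkl : b = 0 ∧ k = l
  · obtain ⟨rfl, rfl⟩ := hkl
    rw [h3, if_neg hij, if_pos ⟨rfl, rfl⟩]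
    simp only [one_smul, smul_sub, smul_add, mul_add, add_mul, mul_one, one_mul,
      smul_mul_assoc, mul_smul_comm, zero_add]
    abel
  · rw [if_neg hij, if_neg hkl, zero_add, zero_add]
    simp only [smul_sub, smul_mul_assoc, mul_smul_comm]
    rw [smul_comm hbar (sgn _), smul_comm hbar (sgn _)]

/-- The canonical map from the free algebra to the double Yangian. -/
noncomputable def toDY (m n : ℕ) : Free m n →ₐ[Base] DY m n :=
  (toCompletion (Presented m n)).comp (toPresented m n)

theorem toDY_eq_zero {x : Free m n} (hx : Rel m n x 0) : toDY m n x = 0 := by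
  have : toPresented m n x = toPresented m n 0 := RingQuot.mkAlgHom_rel Base hx
  rw [toDY, AlgHom.comp_apply, this, map_zero, map_zero]

/-- The defining relations with the common power of `h` cancelled. -/
theorem toDY_reducedBracket (ε : YSign) (i j k l : Fin (m + n)) (a b : ℤ) :
    hbar • toDY m n (reducedBracket ε i j k l (a - 1) b) -
        hbar • toDY m n (reducedBracket ε i j k l a (b - 1)) =
      sgn (parity i * parity j + parity i * parity l + parity j * parity l) •
        (toDY m n (tCoeff ε k j a) * toDY m n (tCoeff ε i l b) -
          toDY m n (tCoeff ε k j b) * toDY m n (tCoeff ε i l a)) := by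
  set θ := sgn (parity i * parity j + parity j) * sgn (parity k * parity l + parity l) with hθ
  set ζ := sgn (parity i * parity j + parity i * parity l + parity j * parity l) with hζ
  have hθθ : θ * θ = 1 := by
    simp only [hθ, sgn, ← pow_add]
    rw [← two_mul, pow_mul]
    simp
  -- Exactly one `h` is cancelled (`N = 1`). The supercommutators carry `h ^ 2` and keep one `h`;
  -- the terms from `P` lose their explicit `h`. The sign `θ` is common to all terms.
  have h := toDY_eq_zero (Rel.same ε a b i j k l 1
    (θ • (hbar • reducedBracket ε i j k l (a - 1) b - hbar • reducedBracket ε i j k l a (b - 1) -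
      ζ • (tCoeff ε k j a * tCoeff ε i l b - tCoeff ε k j b * tCoeff ε i l a))) ?_)
  · rw [map_zsmul] at h
    have h' := congrArg (θ • ·) h
    simp only [smul_smul, hθθ, one_smul, smul_zero] at h'
    simpa [sub_eq_zero] using h'
  · rw [pow_one, smul_comm hbar θ, smul_sub hbar, smul_sub hbar, smul_reducedBracket, smul_reducedBracket]
    simp only [rttCoeff, Pi.sub_apply, Pi.smul_apply, tensorP_mul, mul_tensorP,
      tensorT1_mul_tensorT2, tensorT2_mul_tensorT1]
    generalize tCoeff ε i j (a - 1) * tCoeff ε k l b = x1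
    generalize tCoeff ε k l b * tCoeff ε i j (a - 1) = x2
    generalize tCoeff ε i j a * tCoeff ε k l (b - 1) = x3
    generalize tCoeff ε k l (b - 1) * tCoeff ε i j a = x4
    generalize tCoeff ε k j a * tCoeff ε i l b = x5
    generalize tCoeff ε k j b * tCoeff ε i l a = x6
    simp only [hθ, hζ]
    rcases parity_eq i with hi | hi <;> rcases parity_eq j with hj | hj <;>
      rcases parity_eq k with hk | hk <;> rcases parity_eq l with hl | hl <;>
      simp only [hi, hj, hk, hl, sgn] <;> norm_num <;> simp only [smul_sub] <;> abel

/-- The exponent of `u` in the term with the `a`-th power of the variable. -/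
def expo (ε : YSign) (a : ℕ) : ℤ :=
  match ε with
  | .plus => a
  | .minus => -a

theorem toDY_tCoeff (ε : YSign) (i j : Fin (m + n)) (a : ℕ) :
    toDY m n (tCoeff ε i j (expo ε a)) = PowerSeries.coeff a (t ε i j) := by
  cases ε with
  | plus => simp [tCoeff, t, expo, toDY, gen]
  | minus =>
    rcases a with _ | a
    · simp [tCoeff, t, expo]
    · have h : -((a : ℤ) + 1) ≠ 0 ∧ -((a : ℤ) + 1) < 0 := by omega
      simp only [tCoeff, expo, Nat.cast_add, Nat.cast_one, h.1, h.2, false_and, if_false, if_true,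
        zero_add, neg_neg, add_sub_cancel_right, Int.toNat_natCast, map_smul]
      simp [t, toDY, gen]

/-- The coefficients of `h⁻¹` times the supercommutator. -/
noncomputable def bracketCoeff (ε : YSign) (i j k l : Fin (m + n)) (a b : ℕ) : DY m n :=
  hbar • toDY m n (reducedBracket ε i j k l (expo ε a) (expo ε b))

theorem smul_bracketCoeff (ε : YSign) (i j k l : Fin (m + n)) (a b : ℕ) :
    hbar • bracketCoeff ε i j k l a b =
      sgn ((parity i + parity j) * (parity k + parity l)) •
        (PowerSeries.coeff a (t ε i j) * PowerSeries.coeff b (t ε k l)) -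
      PowerSeries.coeff b (t ε k l) * PowerSeries.coeff a (t ε i j) := by
  rw [bracketCoeff, ← map_smul, ← map_smul, smul_reducedBracket]
  simp [toDY_tCoeff]

/-- The boundary cases hold because the reduced series have no negative powers of `u` for `plus` and
no constant term in `u⁻¹` for `minus`. -/
theorem dividesDifference_bracketCoeff (ε : YSign) (i j k l : Fin (m + n)) :
    DividesDifference ε (bracketCoeff ε i j k l) fun a b =>
      sgn (parity i * parity j + parity i * parity l + parity j * parity l) •
        (PowerSeries.coeff a (t ε k j) * PowerSeries.coeff b (t ε i l) -
          PowerSeries.coeff b (t ε k j) * PowerSeries.coeff a (t ε i l)) := by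
  have h := fun a b : ℕ => toDY_reducedBracket ε i j k l (expo ε a) (expo ε b)
  simp only [toDY_tCoeff] at h
  cases ε with
  | plus =>
    intro a b
    refine (h a b).symm.trans ?_
    congr 1
    · rcases a with _ | a
      · simp [expo, reducedBracket, reducedCoeff]
      · simp [expo, bracketCoeff]
    · rcases b with _ | b
      · simp [expo, reducedBracket, reducedCoeff]
      · simp [expo, bracketCoeff]
  | minus =>
    refine ⟨fun a b => ?_, fun b => ?_, fun a => ?_⟩
    · refine (h a b).symm.trans ?_
      rw [bracketCoeff, bracketCoeff]
      simp only [expo, Nat.cast_add, Nat.cast_one, neg_add, sub_eq_add_neg]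
    · simp [expo, bracketCoeff, reducedBracket, reducedCoeff]
    · simp [expo, bracketCoeff, reducedBracket, reducedCoeff]

theorem DividesDifference.map {A A' : Type*} [Ring A] [Ring A'] {ε : YSign} {U Y : ℕ → ℕ → A}
    (h : DividesDifference ε U Y) (φ : A →+* A') :
    DividesDifference ε (fun a b => φ (U a b)) (fun a b => φ (Y a b)) := by
  cases ε with
  | plus =>
    intro a b
    have := h a b
    simp only [this, map_sub]
    split_ifs <;> simp
  | minus =>
    obtain ⟨h, h1, h2⟩ := h
    exact ⟨fun a b => by simp [h], fun b => by simp [h1], fun a => by simp [h2]⟩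

/-- The exchange relations after the substitutions `u ↦ u - c h`, `v ↦ u - d h`. -/
theorem shift_exchange (ε : YSign) (c d : ℤ) (i j k l : Fin (m + n)) :
    (d - c) • (sgn ((parity i + parity j) * (parity k + parity l)) •
        (shift ε c (t ε i j) * shift ε d (t ε k l)) -
        shift ε d (t ε k l) * shift ε c (t ε i j)) =
      sgn (parity i * parity j + parity i * parity l + parity j * parity l) •
        (shift ε c (t ε k j) * shift ε d (t ε i l) -
          shift ε d (t ε k j) * shift ε c (t ε i l)) := by
  refine series_ext fun q N => ?_
  have hM := Nat.lt_succ_self (N + q)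
  -- `U` is `h⁻¹` times the supercommutator, so the factor `(d - c) h` gives `d - c` times the
  -- supercommutator itself.
  have key := ((dividesDifference_bracketCoeff ε i j k l).map
    (residue q : DY m n →ₐ[Base] _).toRingHom).sum_eq c d hM
  simp only [AlgHom.toRingHom_eq_coe, RingHom.coe_coe] at key
  simp only [map_zsmul, map_sub, residue_coeff_shift_mul_shift ε c d _ _ hM,
    residue_coeff_shift_mul_shift' ε c d _ _ hM]
  have e1 : ∀ (z : ℤ) (w : ℕ → ℕ → DY m n), z • ∑ a ∈ Finset.range (N + q).succ,
      ∑ b ∈ Finset.range (N + q).succ,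
        PowerSeries.coeff N (node ε c ^ a * node ε d ^ b) • residue q (w a b) =
      ∑ a ∈ Finset.range (N + q).succ, ∑ b ∈ Finset.range (N + q).succ,
        PowerSeries.coeff N (node ε c ^ a * node ε d ^ b) • residue q (z • w a b) := by
    intro z w
    simp only [Finset.smul_sum, map_zsmul]
    simp only [smul_comm z]
  rw [e1, ← Finset.sum_sub_distrib, ← Finset.sum_sub_distrib]
  simp only [← Finset.sum_sub_distrib, ← smul_sub, ← map_sub]
  rw [e1 (sgn (_ + _ + _)), key, mul_smul, Int.cast_smul_eq_zsmul]
  congr 1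
  simp only [← smul_bracketCoeff, map_smul, Finset.smul_sum]
  simp only [smul_comm hbar]

end ExchangeRelations

/-- For `a = b` the right side vanishes; adding the instance with `a` and `b` interchanged makes the
right sides cancel. -/
theorem IsExchange.of_commutator {S : Type*} [Ring S] {N : ℕ} {κ : Type*}
    {X : Fin N → Fin N → κ → S}
    (h : ∀ p q : Fin N, (q : ℕ) = p + 1 → ∀ i k a b,
      X p i a * X q k b - X p k a * X q i b = X q k b * X p i a - X q k a * X p i b) :
    IsExchange X where
  same p q hpq i k a := by
    have := h p q hpq i k a a
    rwa [sub_self, sub_eq_zero] at this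
  swap p q hpq i k a b := by
    have := congrArg₂ (· + ·) (h p q hpq i k a b) (h p q hpq i k b a)
    rw [← sub_eq_zero] at this ⊢
    rw [← this]
    abel

/-! ### An ordinary matrix model of the super tensor square -/

section TensorSquare

variable {m n : ℕ} {S : Type*} [Ring S]

/-- `X ⊗ 1`, in a realization of the even part of `End ℂ^{m|n} ⊗ End ℂ^{m|n} ⊗ S` by ordinary
matrices. -/
def embedLeft (X : Matrix (Fin (m + n)) (Fin (m + n)) S) :
    Matrix (Fin (m + n) × Fin (m + n)) (Fin (m + n) × Fin (m + n)) S :=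
  Matrix.of fun p q => if p.2 = q.2 then X p.1 q.1 else 0

/-- `1 ⊗ X`, in the same realization. -/
def embedRight (X : Matrix (Fin (m + n)) (Fin (m + n)) S) :
    Matrix (Fin (m + n) × Fin (m + n)) (Fin (m + n) × Fin (m + n)) S :=
  Matrix.of fun p q =>
    if p.1 = q.1 then sgn (parity p.1 * (parity p.2 + parity q.2)) • X p.2 q.2 else 0

variable (m n S) in
/-- The graded permutation, in the same realization. -/
def gradedSwap : Matrix (Fin (m + n) × Fin (m + n)) (Fin (m + n) × Fin (m + n)) S :=
  Matrix.of fun p q => if p.2 = q.1 ∧ q.2 = p.1 then sgn (parity p.1 * parity q.1) • 1 else 0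

theorem embedLeft_mul_apply (X : Matrix (Fin (m + n)) (Fin (m + n)) S)
    (Y : Matrix (Fin (m + n) × Fin (m + n)) (Fin (m + n) × Fin (m + n)) S) (i k : Fin (m + n)) (q) :
    (embedLeft X * Y) (i, k) q = ∑ a, X i a * Y (a, k) q := by
  simp [Matrix.mul_apply, Fintype.sum_prod_type, embedLeft]

theorem embedRight_mul_apply (X : Matrix (Fin (m + n)) (Fin (m + n)) S)
    (Y : Matrix (Fin (m + n) × Fin (m + n)) (Fin (m + n) × Fin (m + n)) S) (i k : Fin (m + n)) (q) :
    (embedRight X * Y) (i, k) q =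
      ∑ b, sgn (parity i * (parity k + parity b)) • (X k b * Y (i, b) q) := by
  simp only [Matrix.mul_apply, Fintype.sum_prod_type, embedRight, Matrix.of_apply]
  rw [Finset.sum_eq_single i]
  · simp [-zsmul_eq_mul]
  · intro a _ ha
    simp [ha.symm]
  · simp

theorem gradedSwap_mul_apply
    (Y : Matrix (Fin (m + n) × Fin (m + n)) (Fin (m + n) × Fin (m + n)) S) (i k : Fin (m + n)) (q) :
    (gradedSwap m n S * Y) (i, k) q = sgn (parity i * parity k) • Y (k, i) q := by
  rw [Matrix.mul_apply, Finset.sum_eq_single (k, i)]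
  · simp [gradedSwap]
  · rintro ⟨a, b⟩ _ h
    rw [gradedSwap, Matrix.of_apply, if_neg, zero_mul]
    rintro ⟨h1, h2⟩
    exact h (Prod.ext h1.symm h2)
  · simp

theorem mul_gradedSwap_apply
    (Y : Matrix (Fin (m + n) × Fin (m + n)) (Fin (m + n) × Fin (m + n)) S) (p) (j l : Fin (m + n)) :
    (Y * gradedSwap m n S) p (j, l) = sgn (parity l * parity j) • Y p (l, j) := by
  rw [Matrix.mul_apply, Finset.sum_eq_single (l, j)]
  · simp only [gradedSwap, Matrix.of_apply, and_self, if_true, mul_smul_comm, mul_one]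
  · rintro ⟨a, b⟩ _ h
    rw [gradedSwap, Matrix.of_apply, if_neg, mul_zero]
    rintro ⟨h1, h2⟩
    exact h (Prod.ext h2.symm h1)
  · simp

theorem embedLeft_mul_embedRight (X Y : Matrix (Fin (m + n)) (Fin (m + n)) S)
    (i k j l : Fin (m + n)) : (embedLeft X * embedRight Y) (i, k) (j, l) =
      sgn (parity j * (parity k + parity l)) • (X i j * Y k l) := by
  simp [embedLeft_mul_apply, embedRight, -zsmul_eq_mul]

theorem embedRight_mul_embedLeft (X Y : Matrix (Fin (m + n)) (Fin (m + n)) S)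
    (i k j l : Fin (m + n)) : (embedRight Y * embedLeft X) (i, k) (j, l) =
      sgn (parity i * (parity k + parity l)) • (Y k l * X i j) := by
  simp [embedRight_mul_apply, embedLeft, -zsmul_eq_mul]

theorem embedLeft_mul_eq_one {X Y : Matrix (Fin (m + n)) (Fin (m + n)) S} (h : X * Y = 1) :
    embedLeft X * embedLeft Y = 1 := by
  ext ⟨i, k⟩ ⟨j, l⟩
  have h' := congrFun₂ h i j
  rw [Matrix.mul_apply, Matrix.one_apply] at h'
  rw [embedLeft_mul_apply, Matrix.one_apply]
  by_cases hkl : k = l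
  · simp [embedLeft, hkl, h', Prod.ext_iff]
  · simp [embedLeft, hkl, Prod.ext_iff]

theorem embedRight_mul_eq_one {X Y : Matrix (Fin (m + n)) (Fin (m + n)) S} (h : X * Y = 1) :
    embedRight X * embedRight Y = 1 := by
  ext ⟨i, k⟩ ⟨j, l⟩
  have h' := congrFun₂ h k l
  rw [Matrix.mul_apply, Matrix.one_apply] at h'
  rw [embedRight_mul_apply, Matrix.one_apply]
  by_cases hij : i = j
  · subst hij
    -- The two signs telescope: the parity of the summation index `b` occurs twice.
    have : ∀ b, sgn (parity i * (parity k + parity b)) •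
        (X k b * embedRight Y (i, b) (i, l)) =
        sgn (parity i * (parity k + parity l)) • (X k b * Y b l) := by
      intro b
      rw [embedRight, Matrix.of_apply, if_pos rfl, mul_smul_comm, smul_smul]
      congr 1
      rcases parity_eq i with hi | hi <;> rcases parity_eq b with hj | hj <;>
        rcases parity_eq k with hk | hk <;> rcases parity_eq l with hl | hl <;>
        simp [hi, hj, hk, hl, sgn]
    rw [Finset.sum_congr rfl fun b _ => this b, ← Finset.smul_sum, h']
    by_cases hkl : k = l
    · subst hkl
      rcases parity_eq i with hi | hi <;> rcases parity_eq k with hk | hk <;> simp [hi, hk, sgn]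
    · simp [hkl]
  · simp [embedRight, hij]

/-- If `R T₁ T₂ = T₂ T₁ R` then `T₁⁻¹ T₂⁻¹ R = R T₂⁻¹ T₁⁻¹`. -/
theorem exchange_inverse {M : Type*} [Monoid M] {R x y x' y' : M} (hx : x' * x = 1)
    (hx' : x * x' = 1) (hy : y' * y = 1) (hy' : y * y' = 1) (h : R * (x * y) = y * x * R) :
    x' * y' * R = R * (y' * x') := by
  have h' := congrArg (fun z => x' * y' * z * (y' * x')) h
  have e1 : x' * y' * (R * (x * y)) * (y' * x') = x' * y' * R * (x * (y * y') * x') := by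
    simp only [mul_assoc]
  have e2 : x' * y' * (y * x * R) * (y' * x') = x' * (y' * y) * x * (R * (y' * x')) := by
    simp only [mul_assoc]
  rwa [e1, e2, hy, hy', mul_one, mul_one, hx, hx', mul_one, one_mul] at h'

end TensorSquare

/-! ### The two factors of the Berezinian -/

section Berezinian

variable {m n : ℕ}

theorem map_shift_mul_eq_one (ε : YSign) (c : ℤ) {X Y : Matrix (Fin (m + n)) (Fin (m + n)) (Series m n)}
    (h : X * Y = 1) : X.map (shift ε c) * Y.map (shift ε c) = 1 := by
  have := congrArg (shiftHom ε c).mapMatrix h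
  rwa [map_mul, map_one] at this

theorem shift_mul (ε : YSign) (c : ℤ) (f g : Series m n) :
    shift ε c (f * g) = shift ε c f * shift ε c g := (shiftHom ε c).map_mul f g

theorem shift_zero (ε : YSign) (c : ℤ) : shift ε c (0 : Series m n) = 0 := (shiftHom ε c).map_zero

theorem shift_one (ε : YSign) (c : ℤ) : shift ε c (1 : Series m n) = 1 := (shiftHom ε c).map_one

theorem shift_sum (ε : YSign) (c : ℤ) {ι : Type*} (s : Finset ι) (f : ι → Series m n) :
    shift ε c (∑ i ∈ s, f i) = ∑ i ∈ s, shift ε c (f i) := map_sum (shiftHom ε c) f s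

variable (m n) in
theorem exists_T_eq (ε : YSign) :
    ∃ Z : Matrix (Fin (m + n)) (Fin (m + n)) (Series m n), T m n ε = 1 + hbar • Z := by
  refine ⟨Matrix.of fun i j => PowerSeries.mk fun k => match ε with
    | .minus => if k = 0 then 0 else gen YSign.minus i j (k - 1)
    | .plus => -gen YSign.plus i j k, ?_⟩
  ext i j k
  rw [T, Matrix.of_apply, Matrix.add_apply, Matrix.smul_apply, Matrix.one_apply]
  cases ε <;> by_cases hij : i = j <;> simp [t, hij, PowerSeries.coeff_one, smul_ite]

theorem isUnit_corner_T (ε : YSign) (r : ℕ) (hr : r ≤ m + n) : IsUnit (corner (T m n ε) r hr) := by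
  obtain ⟨Z, hZ⟩ := exists_T_eq m n ε
  have : corner (T m n ε) r hr = 1 + hbar • corner Z r hr := by
    rw [hZ]
    ext i j : 1
    simp [corner, Matrix.one_apply]
  rw [this]
  exact isUnit_one_add_hbar_smul _

theorem isUnit_T (ε : YSign) : IsUnit (T m n ε) := isUnit_corner_T ε (m + n) le_rfl

theorem parity_castAdd (i : Fin m) : parity (Fin.castAdd n i) = 0 := by simp [parity]

theorem parity_natAdd (i : Fin n) : parity (Fin.natAdd m i) = 1 := by simp [parity]

/-- Consecutive shifts differ by `1`, so the factor `d - c` is `1`, and among even indices all signs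
are trivial. -/
theorem isExchange_even (ε : YSign) : IsExchange fun (p i a : Fin m) =>
    shift ε (p : ℤ) (t ε (Fin.castAdd n i) (Fin.castAdd n a)) := by
  refine .of_commutator fun p q hpq i k a b => ?_
  have h := shift_exchange ε p q (Fin.castAdd n i) (Fin.castAdd n a) (Fin.castAdd n k)
    (Fin.castAdd n b)
  rw [show ((q : ℕ) : ℤ) - (p : ℕ) = 1 by rw [hpq]; push_cast; ring] at h
  simp only [parity_castAdd, sgn, mul_zero, add_zero, pow_zero, one_smul] at h
  rw [← sub_eq_zero] at h ⊢
  rw [← h]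
  abel

/-- At the shifts `c` and `c - 1` the factor `u - v - h P` becomes `-h (1 + P)`, so `1 + P` plays
the role of `R` in `exchange_inverse`. Between odd indices the graded permutation carries the sign
`-1`, hence the differences. -/
theorem exchange_tInv (ε : YSign) (c : ℤ) (i j k l : Fin n) :
    shift ε c (tInv ε (Fin.natAdd m i) (Fin.natAdd m j)) *
        shift ε (c - 1) (tInv ε (Fin.natAdd m k) (Fin.natAdd m l)) -
      shift ε c (tInv ε (Fin.natAdd m i) (Fin.natAdd m l)) *
        shift ε (c - 1) (tInv ε (Fin.natAdd m k) (Fin.natAdd m j)) =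
    shift ε (c - 1) (tInv ε (Fin.natAdd m k) (Fin.natAdd m l)) *
        shift ε c (tInv ε (Fin.natAdd m i) (Fin.natAdd m j)) -
      shift ε (c - 1) (tInv ε (Fin.natAdd m i) (Fin.natAdd m l)) *
        shift ε c (tInv ε (Fin.natAdd m k) (Fin.natAdd m j)) := by
  have h1 := Ring.mul_inverse_cancel _ (isUnit_T (m := m) (n := n) ε)
  have h2 := Ring.inverse_mul_cancel _ (isUnit_T (m := m) (n := n) ε)
  have key := exchange_inverse (R := 1 + gradedSwap m n (Series m n))
    (embedLeft_mul_eq_one (map_shift_mul_eq_one ε c h2)) (embedLeft_mul_eq_one (map_shift_mul_eq_one ε c h1))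
    (embedRight_mul_eq_one (map_shift_mul_eq_one ε (c - 1) h2))
    (embedRight_mul_eq_one (map_shift_mul_eq_one ε (c - 1) h1)) ?_
  · have h := congrFun₂ key (Fin.natAdd m i, Fin.natAdd m k) (Fin.natAdd m j, Fin.natAdd m l)
    rw [mul_add, mul_one, add_mul, one_mul, Matrix.add_apply, Matrix.add_apply,
      gradedSwap_mul_apply, mul_gradedSwap_apply] at h
    simp only [embedLeft_mul_embedRight, embedRight_mul_embedLeft, parity_natAdd,
      Matrix.map_apply] at h
    simpa [sgn, sub_eq_add_neg, tInv] using h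
  · ext1 ⟨i, k⟩ ⟨j, l⟩
    rw [mul_add, mul_one, add_mul, one_mul, Matrix.add_apply, Matrix.add_apply,
      gradedSwap_mul_apply, mul_gradedSwap_apply]
    simp only [embedLeft_mul_embedRight, embedRight_mul_embedLeft, Matrix.map_apply]
    have h := shift_exchange ε c (c - 1) i j k l
    rw [sub_sub_cancel_left, neg_one_smul] at h
    simp only [T, Matrix.of_apply]
    generalize shift ε c (t ε i j) * shift ε (c - 1) (t ε k l) = x1 at *
    generalize shift ε (c - 1) (t ε k l) * shift ε c (t ε i j) = x2 at *
    generalize shift ε c (t ε k j) * shift ε (c - 1) (t ε i l) = x3 at *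
    generalize shift ε (c - 1) (t ε k j) * shift ε c (t ε i l) = x4 at *
    revert h
    rcases parity_eq i with hi | hi <;> rcases parity_eq j with hj | hj <;>
      rcases parity_eq k with hk | hk <;> rcases parity_eq l with hl | hl <;>
      simp only [hi, hj, hk, hl, sgn] <;> norm_num <;> intro h <;>
      rw [← sub_eq_zero] at h ⊢ <;> first | (rw [← h]; abel1) | (rw [← neg_eq_zero, ← h]; abel1)

/-- The column label is the first index of `t'` and the permuted index the second; the shifts now
decrease by `1`. -/
theorem isExchange_odd (ε : YSign) : IsExchange fun (p i a : Fin n) =>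
    shift ε ((m : ℤ) - 1 - p) (tInv ε (Fin.natAdd m a) (Fin.natAdd m i)) := by
  refine .of_commutator fun p q hpq i k a b => ?_
  have h := exchange_tInv (m := m) ε ((m : ℤ) - 1 - p) a i b k
  rwa [show (m : ℤ) - 1 - (p : ℕ) - 1 = (m : ℤ) - 1 - (q : ℕ) by rw [hpq]; push_cast; ring] at h

theorem even_factor_eq (ε : YSign) :
    altSum (fun (p i a : Fin m) => shift ε (p : ℤ) (t ε (Fin.castAdd n i) (Fin.castAdd n a))) id =
      (List.ofFn fun k : Fin m => shift ε (k : ℤ) (d ε (Fin.castAdd n k))).prod := by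
  refine (isExchange_even ε).altSum_eq_prod_of_columns
    (fun p j => shift ε (p : ℤ) (colOp (T m n ε) (Fin.castAdd n j) (Fin.castAdd n p))) _
    (fun p => by rw [colOp_self, shift_one])
    (fun p j h => ?_) fun p i h => ?_
  · have h0 := colOp_lower (T m n ε) (Fin.castAdd n j) (Fin.castAdd n p) (Fin.lt_def.2 h)
    rw [h0, shift_zero]
  have key : (T m n ε * colOp (T m n ε)) (Fin.castAdd n i) (Fin.castAdd n p) =
      if i = p then d ε (Fin.castAdd n p) else 0 := by
    rcases h.eq_or_lt with rfl | h
    · rw [mul_colOp_self, if_pos rfl]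
      rfl
    · rw [mul_colOp_upper (isUnit_corner_T ε) _ _ h, if_neg h.ne]
  -- `colOp` is upper triangular, so an even column involves no odd rows and the sum stays in the
  -- even block.
  rw [Matrix.mul_apply, Fin.sum_univ_add, Finset.sum_eq_zero (s := (Finset.univ : Finset (Fin n))),
    add_zero] at key
  · have := congrArg (shift ε (p : ℤ)) key
    rw [shift_sum] at this
    simp only [shift_mul] at this
    rw [apply_ite (shift ε (p : ℤ)), shift_zero] at this
    exact this
  · intro j _
    rw [colOp_lower _ _ _ (by simp [Fin.lt_def]; omega), mul_zero]

theorem odd_factor_eq (ε : YSign) :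
    altSum (fun (p i a : Fin n) =>
        shift ε ((m : ℤ) - 1 - p) (tInv ε (Fin.natAdd m a) (Fin.natAdd m i))) id =
      (List.ofFn fun k : Fin n =>
        shift ε ((m : ℤ) - 1 - k) (Ring.inverse (d ε (Fin.natAdd m k)))).prod := by
  obtain ⟨-, F, E, -, -, hE1, hE0, hF, -, -, -, hT⟩ := gauss_decomposition
    (isUnit_corner_T (m := m) (n := n) ε)
  refine (isExchange_odd ε).altSum_eq_prod_of_rows
    (fun p j => shift ε ((m : ℤ) - 1 - p) (E (Fin.natAdd m p) (Fin.natAdd m j))) _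
    (fun p => by rw [hE1, shift_one])
    (fun p j h => by rw [hE0 _ _ (by simpa using h), shift_zero]) fun p i h => ?_
  have key := unitriangular_mul_inverse (isUnit_corner_T ε) hF hT (Fin.natAdd m p) (Fin.natAdd m i)
    (by simpa using h)
  -- `E` is upper triangular, so an odd row involves no even columns and only the odd block of the
  -- inverse enters.
  rw [Matrix.mul_apply, Fin.sum_univ_add, Finset.sum_eq_zero (s := (Finset.univ : Finset (Fin m))),
    zero_add] at key
  · have := congrArg (shift ε ((m : ℤ) - 1 - p)) key
    rw [shift_sum] at this
    simp only [shift_mul] at this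
    rw [apply_ite (shift ε ((m : ℤ) - 1 - p)), shift_zero] at this
    simp only [Fin.natAdd_inj] at this
    exact this
  · intro j _
    rw [hE0 _ _ (by simp [Fin.lt_def]; omega), zero_mul]

end Berezinian

end DoubleYangian

theorem lemma3 (m n : ℕ) (ε : DoubleYangian.YSign) :
    -- the inverses in the definitions of `tInv` and `d`, and those of the `d`, exist
    IsUnit (DoubleYangian.T m n ε) ∧
    (∀ (r : ℕ) (hr : r ≤ m + n),
      IsUnit (DoubleYangian.leading ε r hr : Matrix _ _ (DoubleYangian.Series m n))) ∧
    (∀ i : Fin (m + n), IsUnit (DoubleYangian.d ε i : DoubleYangian.Series m n)) ∧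
    -- the `d` are the diagonal entries in the Gauss decomposition
    (∃ F E : Matrix (Fin (m + n)) (Fin (m + n)) (DoubleYangian.Series m n),
      (∀ i, F i i = 1) ∧ (∀ i j, i < j → F i j = 0) ∧
      (∀ i, E i i = 1) ∧ (∀ i j, j < i → E i j = 0) ∧
      DoubleYangian.T m n ε = F * Matrix.diagonal (fun i => DoubleYangian.d ε i) * E) ∧
    -- the factorization of the quantum Berezinian
    DoubleYangian.berezinian m n ε =
      (List.ofFn fun k : Fin m =>
        DoubleYangian.shift ε (k : ℤ) (DoubleYangian.d ε (Fin.castAdd n k))).prod *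
      (List.ofFn fun k : Fin n =>
        DoubleYangian.shift ε ((m : ℤ) - 1 - k)
          (Ring.inverse (DoubleYangian.d ε (Fin.natAdd m k)))).prod := by
  obtain ⟨hd, F, E, hF1, hF0, hE1, hE0, -, -, -, -, hT⟩ := DoubleYangian.gauss_decomposition
    (DoubleYangian.isUnit_corner_T (m := m) (n := n) ε)
  refine ⟨DoubleYangian.isUnit_T ε, DoubleYangian.isUnit_corner_T ε, hd,
    ⟨F, E, hF1, hF0, hE1, hE0, hT⟩, ?_⟩
  rw [← DoubleYangian.even_factor_eq, ← DoubleYangian.odd_factor_eq]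
  rfl
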